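/- **Theorem ($k$-Random-to-Top).** For integers $1\le k\le n$, the $k$-random-to-top shuffle is the Markov chain on the $n!$ orderings of a deck of $n$ cards in which, at each step, a uniformly random set of $k$ cards is chosen (without replacement) and moved to the top of the deck, the relative order of the chosen cards and the relative order of the remaining cards being preserved. The uniform distribution is stationary. Let $P_{n,k}$ be its transition matrix and let $$s_{n,k}(t):=\max_{x,y}\left\{1-n!\,P_{n,k}^t(x,y)\right\}$$ be its separation distance from the uniform distribution after $t$ steps, the maximum being over all pairs of orderings $x,y$. Let $(k_n)$ be a sequence of integers with $1\le k_n\le n$ for all large $n$. 1. (Sparse regime.) If $k_n\log n/n\to0$, then for every fixed $c\in\mathbb R$, $$s_{n,k_n}\left(\left\lfloor\frac{n}{k_n}(\log n+c)\right\rfloor\right)\to 1-e^{-e^{-c}}(1+e^{-c})\qquad(n\to\infty).$$ 2. (Dense regime.) Suppose $k_n/n\to\alpha$ for some $\alpha\in(0,1)$, and set $$q_{n,k_n}:=\frac{\binom{k_n}{2}+\binom{n-k_n}{2}}{\binom n2}.$$ Then for every fixed $c\in\mathbb R$ and every sequence $(t_n)$ of nonnegative integers such that $$t_n=\frac{2\log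 n+c+o(1)}{-\log q_{n,k_n}}\qquad(n\to\infty),$$ we have $$s_{n,k_n}(t_n)\to1-\exp\left(-\tfrac12e^{-c}\right)\qquad(n\to\infty).$$ -/

import Mathlib

open Filter Topology

/-- The separation distance at time `t` of a chain on a finite state space `X` with transition
matrix `P` and stationary distribution `π`:
`s(t) = max_x max_y (1 - P ^ t (x, y) / π y)`
(over a finite nonempty `X` the suprema are maxima). -/
noncomputable def separationDistance {X : Type*} [Fintype X] [DecidableEq X]
    (P : Matrix X X ℝ) (π : X → ℝ) (t : ℕ) : ℝ :=
  ⨆ x : X, ⨆ y : X, (1 - (P ^ t) x y / π y)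

/-- A deck of `n` cards is a permutation `σ` of `Fin n`: `σ i` is the card at position `i`, where
position `0` is the top.  `moveToTop S σ` moves the cards of `S` to the top and preserves the
relative order within `S` and within its complement: the positions are sorted stably, those
holding a card of `S` (key `0`) before the others (key `1`). -/
def moveToTop {n : ℕ} (S : Finset (Fin n)) (σ : Equiv.Perm (Fin n)) : Equiv.Perm (Fin n) :=
  σ * Tuple.sort (fun i => if σ i ∈ S then (0 : ℕ) else 1)

/-- Transition matrix of the `k`-random-to-top shuffle of `n` cards: choose a set of `k` cards
uniformly among all `k`-subsets, and move these cards to the top, preserving relative order. -/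
noncomputable def kRandomToTop (n k : ℕ) :
    Matrix (Equiv.Perm (Fin n)) (Equiv.Perm (Fin n)) ℝ :=
  Matrix.of fun σ τ =>
    ((((Finset.univ : Finset (Fin n)).powersetCard k).filter
      (fun S => moveToTop S σ = τ)).card : ℝ) / (n.choose k : ℝ)

/-- The uniform distribution on the decks of `n` cards. -/
noncomputable def uniformDeck (n : ℕ) : Equiv.Perm (Fin n) → ℝ :=
  fun _ => 1 / (n.factorial : ℝ)

/-- The separation distance of the `k`-random-to-top shuffle of `n` cards after `t` steps;
its stationary distribution is uniform. -/
noncomputable def sepKRandomToTop (n k t : ℕ) : ℝ :=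
  separationDistance (kRandomToTop n k) (uniformDeck n) t

/-- `(C(k,2) + C(n-k,2)) / C(n,2)`, used for `k ≤ n` and `2 ≤ n`. -/
noncomputable def pairAgreement (n k : ℕ) : ℝ :=
  ((k.choose 2 : ℝ) + ((n - k).choose 2 : ℝ)) / (n.choose 2 : ℝ)

/-- After the move, card `a` lies above card `b` iff `a` was moved and `b` was not, or both or
neither were moved and `a` lay above `b` before. -/
theorem moveToTop_above {n : ℕ} (S : Finset (Fin n)) (σ : Equiv.Perm (Fin n)) (a b : Fin n) :
    (moveToTop S σ).symm a < (moveToTop S σ).symm b ↔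
      (a ∈ S ∧ b ∉ S) ∨ ((a ∈ S ↔ b ∈ S) ∧ σ.symm a < σ.symm b) := by
  set f : Fin n → ℕ := fun i => if σ i ∈ S then (0 : ℕ) else 1 with hf
  obtain ⟨hm, hs⟩ := (Tuple.eq_sort_iff (f := f) (σ := Tuple.sort f)).1 rfl
  have key : ∀ i j, i < j → (σ (Tuple.sort f i) ∈ S ∧ σ (Tuple.sort f j) ∉ S) ∨
      ((σ (Tuple.sort f i) ∈ S ↔ σ (Tuple.sort f j) ∈ S) ∧ Tuple.sort f i < Tuple.sort f j) := by
    intro i j hij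
    have h1 := hm hij.le
    have h2 := hs i j hij
    simp only [hf, Function.comp] at h1 h2
    by_cases hi : σ (Tuple.sort f i) ∈ S <;> by_cases hj : σ (Tuple.sort f j) ∈ S <;>
      simp_all
  obtain ⟨i, rfl⟩ := (moveToTop S σ).surjective a
  obtain ⟨j, rfl⟩ := (moveToTop S σ).surjective b
  have e : ∀ i, moveToTop S σ i = σ (Tuple.sort f i) := fun i => rfl
  rw [Equiv.symm_apply_apply, Equiv.symm_apply_apply, e i, e j, Equiv.symm_apply_apply,
    Equiv.symm_apply_apply]
  constructor
  · exact key i j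
  · intro h
    rcases lt_trichotomy i j with hij | hij | hij
    · exact hij
    · subst hij; simp at h
    · exfalso
      have h' := key j i hij
      rcases h with h | h <;> rcases h' with h' | h'
      · exact h.2 h'.1
      · exact h.2 (h'.1.2 h.1)
      · exact h'.2 (h.1.2 h'.1)
      · exact absurd h.2 (not_lt.2 h'.2.le)

/-- The transition probabilities out of a deck sum to one. -/
theorem kRandomToTop_row_sum {n k : ℕ} (hk : k ≤ n) (σ : Equiv.Perm (Fin n)) :
    ∑ τ, kRandomToTop n k σ τ = 1 := by
  have hc : (n.choose k : ℝ) ≠ 0 := by exact_mod_cast (Nat.choose_pos hk).ne'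
  simp only [kRandomToTop, Matrix.of_apply]
  rw [← Finset.sum_div, div_eq_one_iff_eq hc]
  have h := Finset.card_eq_sum_card_fiberwise (f := fun S => moveToTop S σ)
    (s := (Finset.univ : Finset (Fin n)).powersetCard k) (t := Finset.univ)
    (fun _ _ => by simp)
  rw [Finset.card_powersetCard, Finset.card_univ, Fintype.card_fin] at h
  exact_mod_cast h.symm

/-- The shuffle commutes with relabelling the cards. -/
theorem kRandomToTop_mul_left (n k : ℕ) (g σ τ : Equiv.Perm (Fin n)) :
    kRandomToTop n k (g * σ) (g * τ) = kRandomToTop n k σ τ := by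
  simp only [kRandomToTop, Matrix.of_apply]
  congr 2
  symm
  refine Finset.card_bij (fun S _ => S.map g.toEmbedding) ?_ ?_ ?_
  · intro S hS
    simp only [Finset.mem_filter, Finset.mem_powersetCard, Finset.subset_univ, true_and,
      Finset.card_map] at hS ⊢
    refine ⟨hS.1, ?_⟩
    rw [← hS.2]
    simp [moveToTop, mul_assoc]
  · intro S _ T _ h
    exact Finset.map_injective _ h
  · intro T hT
    refine ⟨T.map g.symm.toEmbedding, ?_, ?_⟩
    · simp only [Finset.mem_filter, Finset.mem_powersetCard, Finset.subset_univ, true_and,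
        Finset.card_map] at hT ⊢
      refine ⟨hT.1, ?_⟩
      have h2 := hT.2
      simp only [moveToTop, mul_assoc, mul_right_inj, Equiv.Perm.mul_apply] at h2 ⊢
      rw [← h2]
      congr 2
      funext i
      simp only [Finset.mem_map_equiv, Equiv.symm_symm]
      exact if_congr Iff.rfl rfl rfl
    · ext x
      simp

/-- The uniform distribution is stationary for the `k`-random-to-top shuffle. -/
theorem uniformDeck_stationary {n k : ℕ} (hk : k ≤ n) :
    Matrix.vecMul (uniformDeck n) (kRandomToTop n k) = uniformDeck n := by
  funext τ
  simp only [Matrix.vecMul, dotProduct, uniformDeck]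
  rw [← Finset.mul_sum]
  have : ∑ σ, kRandomToTop n k σ τ = 1 := by
    rw [← kRandomToTop_row_sum hk τ]
    refine Fintype.sum_equiv
      ((Equiv.inv _).trans ((Equiv.mulLeft τ).trans (Equiv.mulRight τ))) _ _ ?_
    intro σ
    have := kRandomToTop_mul_left n k (τ * σ⁻¹) σ τ
    simpa using this.symm
  rw [this, mul_one]

/-! A move tells two cards apart when it takes exactly one of them, and the last such move decides
their final order. If every pair is told apart, the final deck does not depend on the initial one,
and by symmetry under relabelling it is equally likely to be any deck. Hence every transition
probability is at least `sepProb` divided by `n!`. Equality holds when the target is the reversed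
deck, because a pair that is never split keeps its order. So the separation distance is the
probability that some pair is never split (`sepKRandomToTop_eq`), and the rest is a problem about
random subsets.

Sparse regime: a pair stays together essentially only if neither card is ever moved, since `t
(k/n)^2` tends to `0`. The binomial moments of the number of cards never moved converge to those of
a Poisson variable of mean `e^{-c}`, and separation asymptotically means that this number is at most
one (`tendsto_sepProb_sparse`).

Dense regime: put `q = α^2 + (1-α)^2` and `μ = e^{-c}/2`, and stop `L` moves before the end. The
number `W` of pairs still unsplit has mean tending to `ν = μ/q^L` and mean square distance from `ν`
asymptotically at most `ν`. Unsplit triples disappear, so the unsplit pairs are disjoint, and the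
last `L` moves split `m` such pairs with probability tending to `(1-q^L)^m`. The answer is thus
close to the expectation of `(1-q^L)^W`, hence to `(1-q^L)^ν`, with an error of order `-log(1-q^L)
√ν`, comparable to `√(μ q^L)`. Letting `L` grow gives `e^{-μ}` (`tendsto_sepProb_dense`). Second
moments suffice; no Poisson limit for `W` is needed. -/

open scoped BigOperators

/-! ### Real-valued indicators -/

/-- The real number `1` if `p` holds and `0` otherwise. -/
noncomputable def ind (p : Prop) : ℝ := open Classical in if p then 1 else 0

theorem ind_of {p : Prop} (h : p) : ind p = 1 := if_pos h

theorem ind_of_not {p : Prop} (h : ¬ p) : ind p = 0 := if_neg h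

theorem ind_nonneg (p : Prop) : 0 ≤ ind p := by
  unfold ind; split_ifs <;> norm_num

theorem ind_le_one (p : Prop) : ind p ≤ 1 := by
  unfold ind; split_ifs <;> norm_num

theorem ind_mono {p q : Prop} (h : p → q) : ind p ≤ ind q := by
  by_cases hp : p
  · rw [ind_of hp, ind_of (h hp)]
  · rw [ind_of_not hp]; exact ind_nonneg q

theorem ind_congr {p q : Prop} (h : p ↔ q) : ind p = ind q := by rw [propext h]

theorem ind_and (p q : Prop) : ind (p ∧ q) = ind p * ind q := by
  by_cases hp : p <;> by_cases hq : q <;> simp [ind, hp, hq]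

theorem ind_not (p : Prop) : ind (¬ p) = 1 - ind p := by
  by_cases hp : p <;> simp [ind, hp]

theorem prod_ind {ι : Type*} (s : Finset ι) (p : ι → Prop) :
    ∏ i ∈ s, ind (p i) = ind (∀ i ∈ s, p i) := by
  classical
  simp only [ind, Finset.prod_boole]
  split_ifs <;> rfl

theorem ite_eq_ind (p : Prop) [Decidable p] : (if p then (1 : ℝ) else 0) = ind p := by
  unfold ind; congr

/-! ### The chain as a sequence of independent uniform moves -/

/-- The sets of `k` cards that one shuffle may move. -/
abbrev KSet (n k : ℕ) := {S : Finset (Fin n) // S.card = k}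

theorem kSet_nonempty {n k : ℕ} (hk : k ≤ n) : Nonempty (KSet n k) := by
  obtain ⟨S, -, hS⟩ := Finset.exists_subset_card_eq (s := (Finset.univ : Finset (Fin n)))
    (n := k) (by simpa using hk)
  exact ⟨⟨S, hS⟩⟩

theorem card_kSet (n k : ℕ) : Fintype.card (KSet n k) = n.choose k := by
  rw [Fintype.card_finset_len, Fintype.card_fin]

/-- The deck after the successive moves `ω 0, ω 1, …`. -/
def runMoves {n k : ℕ} : ∀ {t : ℕ}, (Fin t → KSet n k) → Equiv.Perm (Fin n) → Equiv.Perm (Fin n)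
  | 0, _, σ => σ
  | _ + 1, ω, σ => runMoves (Fin.tail ω) (moveToTop (ω 0).1 σ)

/-- Expectation over `t + 1` independent moves, conditioning on the first one. -/
theorem expect_cons {α : Type*} [Fintype α] {t : ℕ} (f : (Fin (t + 1) → α) → ℝ) :
    𝔼 ω, f ω = 𝔼 S, 𝔼 ω : Fin t → α, f (Fin.cons S ω) := by
  rw [← Finset.expect_product' (f := fun S (ω : Fin t → α) => f (Fin.cons S ω))]
  rw [Finset.univ_product_univ]
  exact (Fintype.expect_equiv (Fin.consEquiv (fun _ => α)) _ _ (fun x => rfl)).symm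

/-- Expectation over `u + v` independent moves, conditioning on the first `u`. -/
theorem expect_append {α : Type*} [Fintype α] {u v : ℕ} (f : (Fin (u + v) → α) → ℝ) :
    𝔼 ω, f ω = 𝔼 ω₁ : Fin u → α, 𝔼 ω₂ : Fin v → α, f (Fin.append ω₁ ω₂) := by
  rw [← Finset.expect_product' (f := fun (ω₁ : Fin u → α) (ω₂ : Fin v → α) =>
    f (Fin.append ω₁ ω₂)), Finset.univ_product_univ]
  exact (Fintype.expect_equiv (Fin.appendEquiv u v) _ _ (fun x => rfl)).symm

theorem kRandomToTop_eq_expect (n k : ℕ) (σ τ : Equiv.Perm (Fin n)) :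
    kRandomToTop n k σ τ = 𝔼 S : KSet n k, ind (moveToTop S.1 σ = τ) := by
  rw [Fintype.expect_eq_sum_div_card, card_kSet]
  simp only [kRandomToTop, Matrix.of_apply]
  congr 1
  rw [Finset.card_filter]
  push_cast
  simp only [ite_eq_ind]
  rw [Finset.sum_subtype (p := fun S : Finset (Fin n) => S.card = k)]
  simp

theorem kRandomToTop_pow_eq_expect (n k t : ℕ) (σ τ : Equiv.Perm (Fin n)) :
    (kRandomToTop n k ^ t) σ τ =
      𝔼 ω : Fin t → KSet n k, ind (runMoves ω σ = τ) := by
  induction t generalizing σ with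
  | zero =>
    rw [Fintype.expect_eq_sum_div_card]
    simp [Matrix.one_apply, runMoves, ite_eq_ind]
  | succ t ih =>
    rw [pow_succ', Matrix.mul_apply, expect_cons]
    simp only [ih, kRandomToTop_eq_expect, Finset.expect_mul]
    rw [← Finset.expect_sum_comm]
    refine Finset.expect_congr rfl fun S _ => ?_
    rw [Finset.sum_eq_single (moveToTop S.1 σ)]
    · simp [ind_of, runMoves]
    · intro z _ hz; simp [ind_of_not hz.symm]
    · simp

/-! ### Separation distance as the probability of an unsplit pair -/

/-- A move `S` leaves the cards of `A` together: it takes all of them or none. -/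
def Unsplit {n : ℕ} (S A : Finset (Fin n)) : Prop := A ⊆ S ∨ Disjoint A S

/-- No move of `ω` splits the set `A` of cards. -/
def NeverSplit {n k t : ℕ} (ω : Fin t → KSet n k) (A : Finset (Fin n)) : Prop :=
  ∀ s, Unsplit (ω s).1 A

/-- Any two cards are told apart by some move of `ω`. -/
def Separating {n k t : ℕ} (ω : Fin t → KSet n k) : Prop :=
  ∀ p : Finset (Fin n), p.card = 2 → ¬ NeverSplit ω p

theorem unsplit_pair_iff {n : ℕ} (S : Finset (Fin n)) (a b : Fin n) :
    Unsplit S {a, b} ↔ (a ∈ S ↔ b ∈ S) := by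
  simp only [Unsplit, Finset.insert_subset_iff, Finset.singleton_subset_iff,
    Finset.disjoint_insert_left, Finset.disjoint_singleton_left]
  tauto

theorem runMoves_lt_iff_of_neverSplit {n k t : ℕ} (ω : Fin t → KSet n k)
    (σ : Equiv.Perm (Fin n)) {a b : Fin n} (h : NeverSplit ω {a, b}) :
    (runMoves ω σ).symm a < (runMoves ω σ).symm b ↔ σ.symm a < σ.symm b := by
  induction t generalizing σ with
  | zero => rfl
  | succ t ih =>
    have h0 := (unsplit_pair_iff _ _ _).1 (h 0)
    have ht : NeverSplit (Fin.tail ω) {a, b} := fun s => h s.succ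
    rw [runMoves, ih _ _ ht, moveToTop_above]
    tauto

/-- The last move that splits the pair puts the card it takes above the other, whatever came before,
and later moves preserve that order. -/
theorem runMoves_lt_iff_of_not_neverSplit {n k t : ℕ} (ω : Fin t → KSet n k)
    (σ σ' : Equiv.Perm (Fin n)) {a b : Fin n} (h : ¬ NeverSplit ω {a, b}) :
    (runMoves ω σ).symm a < (runMoves ω σ).symm b ↔
      (runMoves ω σ').symm a < (runMoves ω σ').symm b := by
  induction t generalizing σ σ' with
  | zero => exact absurd (fun s => s.elim0) h
  | succ t ih =>
    by_cases h1 : NeverSplit (Fin.tail ω) {a, b}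
    · have h0 : ¬ Unsplit (ω 0).1 {a, b} := fun h0 => h (Fin.cases h0 h1)
      rw [unsplit_pair_iff] at h0
      rw [runMoves, runMoves, runMoves_lt_iff_of_neverSplit _ _ h1,
        runMoves_lt_iff_of_neverSplit _ _ h1, moveToTop_above, moveToTop_above]
      tauto
    · exact ih _ _ _ h1

theorem perm_ext_of_lt_iff {n : ℕ} {σ τ : Equiv.Perm (Fin n)}
    (h : ∀ a b, σ.symm a < σ.symm b ↔ τ.symm a < τ.symm b) : σ = τ := by
  have hm : StrictMono (σ.trans τ.symm) := by
    intro i j hij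
    have := (h (σ i) (σ j)).1 (by simpa using hij)
    simpa using this
  have h2 : (σ.trans τ.symm : Fin n → Fin n) = id :=
    (hm.range_inj strictMono_id).1 (by simp)
  ext i
  have := congrFun h2 i
  simp only [Equiv.trans_apply, id, Equiv.symm_apply_eq] at this
  rw [this]

theorem runMoves_eq_of_separating {n k t : ℕ} {ω : Fin t → KSet n k} (h : Separating ω)
    (σ σ' : Equiv.Perm (Fin n)) : runMoves ω σ = runMoves ω σ' := by
  refine perm_ext_of_lt_iff fun a b => ?_
  by_cases hab : a = b
  · simp [hab]
  · exact runMoves_lt_iff_of_not_neverSplit ω σ σ' (h _ (Finset.card_pair hab))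

/-- Relabelling of the cards, acting on moves. -/
def relabel {n k : ℕ} (g : Equiv.Perm (Fin n)) : KSet n k ≃ KSet n k where
  toFun S := ⟨S.1.map g.toEmbedding, by simp [S.2]⟩
  invFun S := ⟨S.1.map g.symm.toEmbedding, by simp [S.2]⟩
  left_inv S := by ext; simp
  right_inv S := by ext; simp

theorem moveToTop_map {n : ℕ} (g : Equiv.Perm (Fin n)) (S : Finset (Fin n))
    (σ : Equiv.Perm (Fin n)) :
    moveToTop (S.map g.toEmbedding) (g * σ) = g * moveToTop S σ := by
  simp [moveToTop, mul_assoc]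

theorem runMoves_relabel {n k t : ℕ} (g : Equiv.Perm (Fin n)) (ω : Fin t → KSet n k)
    (σ : Equiv.Perm (Fin n)) :
    runMoves (fun s => relabel g (ω s)) (g * σ) = g * runMoves ω σ := by
  induction t generalizing σ with
  | zero => rfl
  | succ t ih =>
    have := ih (Fin.tail ω) (moveToTop (ω 0).1 σ)
    rw [← moveToTop_map] at this
    exact this

theorem separating_relabel_iff {n k t : ℕ} (g : Equiv.Perm (Fin n)) (ω : Fin t → KSet n k) :
    Separating (fun s => relabel g (ω s)) ↔ Separating ω := by
  have key : ∀ A, NeverSplit (fun s => relabel g (ω s)) (A.map g.toEmbedding) ↔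
      NeverSplit ω A := fun A => forall_congr' fun s => by
    simp [Unsplit, relabel]
  constructor
  · intro h p hp hn
    exact h (p.map g.toEmbedding) (by simpa using hp) ((key p).2 hn)
  · intro h p hp hn
    refine h (p.map g.symm.toEmbedding) (by simpa using hp) ((key _).1 ?_)
    convert hn
    ext; simp

/-- The probability that `t` moves tell all cards apart. -/
noncomputable def sepProb (n k t : ℕ) : ℝ :=
  𝔼 ω : Fin t → KSet n k, ind (Separating ω)

/-- Relabelling the moves permutes the possible outcomes transitively and preserves separation. It
also relabels the initial deck, but on the separating event the initial deck is irrelevant. So all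
`n!` outcomes carry equal mass, and these masses add up to `sepProb`. -/
theorem expect_separating_runMoves_eq (n k t : ℕ) (σ τ : Equiv.Perm (Fin n)) :
    𝔼 ω : Fin t → KSet n k, ind (Separating ω ∧ runMoves ω σ = τ) =
      sepProb n k t / n.factorial := by
  have hconst : ∀ τ' : Equiv.Perm (Fin n),
      𝔼 ω : Fin t → KSet n k, ind (Separating ω ∧ runMoves ω σ = τ') =
      𝔼 ω : Fin t → KSet n k, ind (Separating ω ∧ runMoves ω σ = τ) := by
    intro τ'
    refine Fintype.expect_equiv
      (Equiv.arrowCongr (Equiv.refl _) (relabel (τ * τ'⁻¹))) _ _ fun ω => ?_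
    have e : (Equiv.arrowCongr (Equiv.refl (Fin t)) (relabel (k := k) (τ * τ'⁻¹))) ω =
      fun s => relabel (τ * τ'⁻¹) (ω s) := rfl
    rw [e, separating_relabel_iff]
    refine ind_congr (and_congr_right fun hs => ?_)
    -- Separation allows the start `σ` to be replaced by its relabelled copy, after which
    -- equivariance applies.
    rw [runMoves_eq_of_separating ((separating_relabel_iff _ _).2 hs) σ ((τ * τ'⁻¹) * σ),
      runMoves_relabel]
    constructor
    · rintro rfl; simp
    · intro h; rw [mul_assoc, mul_eq_left] at h; exact (inv_mul_eq_one.1 h).symm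
  rw [eq_div_iff (by positivity), mul_comm]
  have h1 := Finset.sum_congr (rfl : (Finset.univ : Finset (Equiv.Perm (Fin n))) = _)
    fun τ' _ => hconst τ'
  rw [← Finset.expect_sum_comm, Finset.sum_const, Finset.card_univ, Fintype.card_perm,
    Fintype.card_fin, nsmul_eq_mul] at h1
  rw [← h1, sepProb]
  refine Finset.expect_congr rfl fun ω _ => ?_
  rw [Finset.sum_congr rfl fun τ' _ => ind_and _ _, ← Finset.mul_sum,
    Finset.sum_eq_single (runMoves ω σ) (fun τ' _ h => ind_of_not h.symm) (by simp)]
  simp [ind_of]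

theorem sepProb_div_le_pow (n k t : ℕ) (σ τ : Equiv.Perm (Fin n)) :
    sepProb n k t / n.factorial ≤ (kRandomToTop n k ^ t) σ τ := by
  rw [← expect_separating_runMoves_eq n k t σ τ, kRandomToTop_pow_eq_expect]
  exact Finset.expect_le_expect fun ω _ => ind_mono fun h => h.2

/-- Reversal inverts every pair, whereas an unsplit pair keeps its order; so the reversed deck can
only be reached by separating moves, and the lower bound is attained. -/
theorem pow_reverse_eq_sepProb_div (n k t : ℕ) (σ : Equiv.Perm (Fin n)) :
    (kRandomToTop n k ^ t) σ (σ * Fin.revPerm) = sepProb n k t / n.factorial := by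
  rw [← expect_separating_runMoves_eq n k t σ (σ * Fin.revPerm), kRandomToTop_pow_eq_expect]
  refine Finset.expect_congr rfl fun ω _ => ind_congr ?_
  refine ⟨fun h => ⟨fun p hp hn => ?_, h⟩, fun h => h.2⟩
  obtain ⟨a, b, hab, rfl⟩ := Finset.card_eq_two.1 hp
  have h1 := runMoves_lt_iff_of_neverSplit ω σ hn
  rw [Finset.pair_comm] at hn
  have h2 := runMoves_lt_iff_of_neverSplit ω σ hn
  have e : ∀ x, (σ * Fin.revPerm).symm x = Fin.rev (σ.symm x) := fun x => rfl
  rw [h, e, e, Fin.rev_lt_rev] at h1 h2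
  have : σ.symm a ≠ σ.symm b := fun h => hab (σ.symm.injective h)
  rcases lt_or_gt_of_ne this with h3 | h3
  · exact lt_asymm h3 (h1.2 h3)
  · exact lt_asymm h3 (h2.2 h3)

/-- The separation distance is the probability that some two cards are not told apart. -/
theorem sepKRandomToTop_eq (n k t : ℕ) : sepKRandomToTop n k t = 1 - sepProb n k t := by
  have hf : (n.factorial : ℝ) ≠ 0 := by positivity
  have hle : ∀ σ τ : Equiv.Perm (Fin n),
      1 - (kRandomToTop n k ^ t) σ τ / uniformDeck n τ ≤ 1 - sepProb n k t := by
    intro σ τ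
    have := sepProb_div_le_pow n k t σ τ
    rw [div_le_iff₀ (by positivity)] at this
    simp only [uniformDeck]
    rw [div_div_eq_mul_div, div_one]
    linarith
  rw [sepKRandomToTop, separationDistance]
  refine le_antisymm (ciSup_le fun σ => ciSup_le fun τ => hle σ τ) ?_
  refine le_ciSup_of_le (Set.finite_range _).bddAbove 1
    (le_ciSup_of_le (Set.finite_range _).bddAbove (1 * Fin.revPerm) ?_)
  rw [pow_reverse_eq_sepProb_div]
  simp only [uniformDeck]
  field_simp
  exact le_rfl

/-! ### One uniform `k`-subset, and independence over time -/

/-- The probability that a uniform `k`-subset of `n` cards contains `b` given cards and avoids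
`z` other given cards. -/
noncomputable def patternProb (n k b z : ℕ) : ℝ :=
  (k.descFactorial b * (n - k).descFactorial z : ℝ) / (n.descFactorial (b + z) : ℝ)

theorem choose_mul_descFactorial {n k b z : ℕ} (hk : k ≤ n) (hbk : b ≤ k) (hn : b + z ≤ n) :
    (n - (b + z)).choose (k - b) * n.descFactorial (b + z) =
      n.choose k * (k.descFactorial b * (n - k).descFactorial z) := by
  -- With `k = b + x` and `n - k = z + y`, everything reduces to factorials. If `z` exceeds `n - k`,
  -- both sides vanish.
  by_cases hz : z ≤ n - k
  · obtain ⟨l, rfl⟩ := Nat.exists_eq_add_of_le hk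
    obtain ⟨x, rfl⟩ := Nat.exists_eq_add_of_le hbk
    rw [Nat.add_sub_cancel_left] at hz ⊢
    obtain ⟨y, rfl⟩ := Nat.exists_eq_add_of_le hz
    have e1 : b + x + (z + y) - (b + z) = x + y := by omega
    rw [e1, Nat.add_sub_cancel_left]
    have h1 := Nat.factorial_mul_descFactorial (n := b + x + (z + y)) (k := b + z) (by omega)
    have h2 := Nat.factorial_mul_descFactorial (n := b + x) (k := b) (by omega)
    have h3 := Nat.factorial_mul_descFactorial (n := z + y) (k := z) (by omega)
    have h4 := Nat.choose_mul_factorial_mul_factorial (Nat.le_add_right x y)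
    have h5 := Nat.choose_mul_factorial_mul_factorial (Nat.le_add_right (b + x) (z + y))
    rw [Nat.add_sub_cancel_left] at h4 h5
    rw [e1] at h1
    rw [Nat.add_sub_cancel_left] at h2 h3
    have hpos : 0 < x.factorial * y.factorial := by positivity
    refine Nat.eq_of_mul_eq_mul_left hpos ?_
    calc _ = ((x + y).choose x * x.factorial * y.factorial) *
          (b + x + (z + y)).descFactorial (b + z) := by ring
      _ = (b + x + (z + y)).choose (b + x) * (x.factorial * (b + x).descFactorial b) *
          (y.factorial * (z + y).descFactorial z) := by rw [h4, h1, h2, h3, h5]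
      _ = _ := by ring
  · rw [Nat.choose_eq_zero_of_lt (by omega), (Nat.descFactorial_eq_zero_iff_lt).2 (by omega : n - k < z)]
    simp

theorem card_kSet_pattern {n k : ℕ} (B Z : Finset (Fin n)) (hBZ : Disjoint B Z)
    (hBk : B.card ≤ k) :
    (((Finset.univ : Finset (Fin n)).powersetCard k).filter
      (fun S => B ⊆ S ∧ Disjoint Z S)).card = (n - (B.card + Z.card)).choose (k - B.card) := by
  have e : (n - (B.card + Z.card)).choose (k - B.card) =
      ((Finset.univ \ (B ∪ Z)).powersetCard (k - B.card)).card := by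
    rw [Finset.card_powersetCard, Finset.card_sdiff_of_subset (Finset.subset_univ _),
      Finset.card_union_of_disjoint hBZ, Finset.card_univ, Fintype.card_fin]
  rw [e]
  refine Finset.card_bij' (fun S _ => S \ B) (fun T _ => T ∪ B) ?_ ?_ ?_ ?_
  · intro S hS
    simp only [Finset.mem_filter, Finset.mem_powersetCard, Finset.subset_univ, true_and] at hS ⊢
    refine ⟨?_, by rw [Finset.card_sdiff_of_subset hS.2.1, hS.1]⟩
    intro x hx
    have := hS.2.2
    rw [Finset.disjoint_right] at this
    simp only [Finset.mem_sdiff, Finset.mem_union, Finset.mem_univ, true_and] at hx ⊢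
    exact fun h => h.elim hx.2 (this hx.1)
  · intro T hT
    simp only [Finset.mem_filter, Finset.mem_powersetCard, Finset.subset_univ, true_and] at hT ⊢
    have hd : ∀ x ∈ T, x ∉ B ∧ x ∉ Z := fun x hx => by
      simpa using hT.1 hx
    refine ⟨?_, Finset.subset_union_right, ?_⟩
    · rw [Finset.card_union_of_disjoint (Finset.disjoint_left.2 fun x hx => (hd x hx).1), hT.2]
      omega
    · rw [Finset.disjoint_union_right]
      exact ⟨Finset.disjoint_right.2 fun x hx => (hd x hx).2, hBZ.symm⟩
  · intro S hS
    simp only [Finset.mem_filter] at hS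
    exact Finset.sdiff_union_of_subset hS.2.1
  · intro T hT
    simp only [Finset.mem_powersetCard] at hT
    refine Finset.union_sdiff_cancel_right (Finset.disjoint_left.2 fun x hx => ?_)
    have := hT.1 hx
    simp only [Finset.mem_sdiff, Finset.mem_union, Finset.mem_univ, true_and] at this
    tauto

theorem expect_pattern {n k : ℕ} (hk : k ≤ n) (B Z : Finset (Fin n)) (hBZ : Disjoint B Z) :
    𝔼 S : KSet n k, ind (B ⊆ S.1 ∧ Disjoint Z S.1) =
      patternProb n k B.card Z.card := by
  have e : ∑ S : KSet n k, ind (B ⊆ S.1 ∧ Disjoint Z S.1) =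
      ((((Finset.univ : Finset (Fin n)).powersetCard k).filter
        (fun S => B ⊆ S ∧ Disjoint Z S)).card : ℝ) := by
    classical
    rw [Finset.card_filter]
    push_cast
    simp only [ite_eq_ind]
    rw [Finset.sum_subtype (p := fun S : Finset (Fin n) => S.card = k)]
    simp
  rw [Fintype.expect_eq_sum_div_card, card_kSet, e, patternProb]
  have hn : B.card + Z.card ≤ n := by
    rw [← Finset.card_union_of_disjoint hBZ]
    simpa using Finset.card_le_univ (B ∪ Z)
  have h1 : (n.choose k : ℝ) ≠ 0 := by exact_mod_cast (Nat.choose_pos hk).ne'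
  have h2 : (n.descFactorial (B.card + Z.card) : ℝ) ≠ 0 := by
    have := (Nat.descFactorial_eq_zero_iff_lt (n := n) (k := B.card + Z.card)).not.2 (by omega)
    exact_mod_cast this
  by_cases hBk : B.card ≤ k
  · rw [card_kSet_pattern B Z hBZ hBk, div_eq_div_iff h1 h2]
    have := choose_mul_descFactorial hk hBk hn
    rw [mul_comm (k.descFactorial _ * _ : ℝ)]
    exact_mod_cast this
  -- Here the truncated `k - B.card` would give a wrong count, but both sides are zero: no `k`-set
  -- contains `B`.
  · rw [(Nat.descFactorial_eq_zero_iff_lt).2 (by omega : k < B.card), Finset.card_eq_zero.2]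
    · simp
    · rw [Finset.filter_eq_empty_iff]
      intro S hS h
      rw [Finset.mem_powersetCard] at hS
      exact hBk (hS.2 ▸ Finset.card_le_card h.1)

/-- Independence of the moves. -/
theorem expect_forall_eq_pow {α : Type*} [Fintype α] (t : ℕ) (Q : α → Prop) :
    𝔼 ω : Fin t → α, ind (∀ s, Q (ω s)) =
      (𝔼 S, ind (Q S)) ^ t := by
  rw [Fintype.expect_eq_sum_div_card, Fintype.expect_eq_sum_div_card, div_pow, Fintype.sum_pow,
    Fintype.card_fun, Fintype.card_fin]
  push_cast
  congr 1
  refine Finset.sum_congr rfl fun ω _ => ?_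
  rw [prod_ind]
  simp

/-- The probability that a uniform `k`-subset of `n` cards splits none of `j` disjoint pairs. -/
noncomputable def pairsProb (n k j : ℕ) : ℝ :=
  ∑ i ∈ Finset.range (j + 1), (j.choose i : ℝ) * patternProb n k (2 * i) (2 * (j - i))

/-- Being taken whole and being avoided exclude each other, except for the empty set, which would be
counted twice. -/
theorem ind_unsplit_eq_add {n : ℕ} {S A : Finset (Fin n)} (hA : A.Nonempty) :
    ind (Unsplit S A) =
      ind (A ⊆ S) + ind (Disjoint A S) := by
  have : ¬ (A ⊆ S ∧ Disjoint A S) := fun ⟨h1, h2⟩ => by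
    obtain ⟨x, hx⟩ := hA
    exact Finset.disjoint_left.1 h2 hx (h1 hx)
  by_cases h1 : A ⊆ S <;> by_cases h2 : Disjoint A S <;> simp_all [ind, Unsplit]

theorem expect_unsplit {n k : ℕ} (hk : k ≤ n) {A : Finset (Fin n)} (hA : A.Nonempty) :
    𝔼 S : KSet n k, ind (Unsplit S.1 A) =
      patternProb n k A.card 0 + patternProb n k 0 A.card := by
  simp only [ind_unsplit_eq_add hA, Finset.expect_add_distrib]
  have h1 := expect_pattern hk A ∅ (by simp)
  have h2 := expect_pattern hk ∅ A (by simp)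
  simp only [Finset.card_empty, Finset.disjoint_empty_left, and_true, Finset.empty_subset,
    true_and] at h1 h2
  rw [h1, h2]

/-- Expanding the product of "taken whole" plus "avoided" over the pairs gives a sum over the
subfamily `I` of pairs taken. Disjointness fixes the numbers of cards involved, so each term depends
only on `I.card`. -/
theorem expect_forall_unsplit {n k : ℕ} (hk : k ≤ n) {J : Finset (Finset (Fin n))}
    (hJ : ∀ p ∈ J, p.card = 2) (hd : (J : Set (Finset (Fin n))).PairwiseDisjoint id) :
    𝔼 S : KSet n k, ind (∀ p ∈ J, Unsplit S.1 p) = pairsProb n k J.card := by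
  have hne : ∀ p ∈ J, p.Nonempty := fun p hp => Finset.card_pos.1 (by rw [hJ p hp]; norm_num)
  have hcard : ∀ I ⊆ J, (I.biUnion id).card = 2 * I.card := by
    intro I hI
    rw [Finset.card_biUnion fun x hx y hy hxy => hd (hI hx) (hI hy) hxy,
      Finset.sum_congr rfl (fun p hp => (hJ p (hI hp) : (id p).card = 2)), Finset.sum_const, smul_eq_mul, mul_comm]
  have h1 : ∀ S : KSet n k, ind (∀ p ∈ J, Unsplit S.1 p) =
      ∑ I ∈ J.powerset, ind (I.biUnion id ⊆ S.1 ∧ Disjoint ((J \ I).biUnion id) S.1) := by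
    intro S
    rw [← prod_ind, Finset.prod_congr rfl fun p hp => ind_unsplit_eq_add (hne p hp),
      Finset.prod_add]
    refine Finset.sum_congr rfl fun I _ => ?_
    rw [prod_ind, prod_ind, ← ind_and]
    simp only [Finset.biUnion_subset, Finset.disjoint_biUnion_left, id]
  have h2 : ∀ I ∈ J.powerset, 𝔼 S : KSet n k, ind (I.biUnion id ⊆ S.1 ∧
      Disjoint ((J \ I).biUnion id) S.1) =
      patternProb n k (2 * I.card) (2 * (J.card - I.card)) := by
    intro I hI
    rw [Finset.mem_powerset] at hI
    rw [expect_pattern hk, hcard I hI, hcard _ Finset.sdiff_subset,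
      Finset.card_sdiff_of_subset hI]
    simp only [Finset.disjoint_biUnion_left, Finset.disjoint_biUnion_right, id]
    intro q hq p hp
    rw [Finset.mem_sdiff] at hq
    exact hd (hI hp) hq.1 fun h => hq.2 (h ▸ hp)
  simp only [h1]
  rw [Finset.expect_sum_comm, Finset.sum_congr rfl h2,
    Finset.sum_powerset_apply_card (fun i => patternProb n k (2 * i) (2 * (J.card - i)))]
  simp only [nsmul_eq_mul, pairsProb]

theorem expect_neverSplit_pairs {n k : ℕ} (hk : k ≤ n) (t : ℕ) {J : Finset (Finset (Fin n))}
    (hJ : ∀ p ∈ J, p.card = 2) (hd : (J : Set (Finset (Fin n))).PairwiseDisjoint id) :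
    𝔼 ω : Fin t → KSet n k, ind (∀ p ∈ J, NeverSplit ω p) =
      pairsProb n k J.card ^ t := by
  rw [← expect_forall_unsplit hk hJ hd, ← expect_forall_eq_pow]
  refine Finset.expect_congr rfl fun ω _ => ind_congr ?_
  exact ⟨fun h s p hp => h p hp s, fun h p hp s => h s p hp⟩

theorem expect_neverSplit {n k : ℕ} (hk : k ≤ n) (t : ℕ) {A : Finset (Fin n)}
    (hA : A.Nonempty) :
    𝔼 ω : Fin t → KSet n k, ind (NeverSplit ω A) =
      (patternProb n k A.card 0 + patternProb n k 0 A.card) ^ t := by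
  rw [← expect_unsplit hk hA, ← expect_forall_eq_pow]
  rfl

/-- The probability that no card of `A` is ever moved. -/
theorem expect_neverMoved {n k : ℕ} (hk : k ≤ n) (t : ℕ) (A : Finset (Fin n)) :
    𝔼 ω : Fin t → KSet n k, ind (∀ s, Disjoint A (ω s).1) =
      patternProb n k 0 A.card ^ t := by
  have h2 := expect_pattern hk ∅ A (by simp)
  simp only [Finset.card_empty, Finset.empty_subset, true_and] at h2
  rw [← h2, ← expect_forall_eq_pow]

theorem pairAgreement_eq (n k : ℕ) :
    pairAgreement n k = patternProb n k 2 0 + patternProb n k 0 2 := by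
  have h : ∀ m : ℕ, (m.descFactorial 2 : ℝ) = 2 * m.choose 2 := fun m => by
    rw [Nat.descFactorial_eq_factorial_mul_choose]; push_cast; rfl
  simp only [pairAgreement, patternProb, Nat.descFactorial_zero, Nat.cast_one, mul_one, one_mul,
    add_zero, zero_add, h]
  rw [← add_div, ← mul_add, mul_div_mul_left _ _ two_ne_zero]

theorem pairsProb_one (n k : ℕ) : pairsProb n k 1 = pairAgreement n k := by
  rw [pairAgreement_eq]
  simp [pairsProb, Finset.sum_range_succ, add_comm]

theorem patternProb_nonneg (n k b z : ℕ) : 0 ≤ patternProb n k b z := by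
  unfold patternProb; positivity

theorem pairAgreement_nonneg (n k : ℕ) : 0 ≤ pairAgreement n k := by
  unfold pairAgreement; positivity

theorem pairsProb_nonneg (n k j : ℕ) : 0 ≤ pairsProb n k j :=
  Finset.sum_nonneg fun _ _ => mul_nonneg (Nat.cast_nonneg _) (patternProb_nonneg _ _ _ _)

/-! ### Cards that are never moved -/

/-- The cards that no move of `ω` takes. -/
def neverMoved {n k t : ℕ} (ω : Fin t → KSet n k) : Finset (Fin n) :=
  Finset.univ.filter fun c => ∀ s, c ∉ (ω s).1

theorem subset_neverMoved_iff {n k t : ℕ} (ω : Fin t → KSet n k) (A : Finset (Fin n)) :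
    A ⊆ neverMoved ω ↔ ∀ s, Disjoint A (ω s).1 := by
  simp only [neverMoved, Finset.subset_iff, Finset.mem_filter, Finset.mem_univ, true_and,
    Finset.disjoint_left]
  exact ⟨fun h s c hc => h hc s, fun h c hc s => h s hc⟩

theorem choose_card_eq_sum_ind {n : ℕ} (N : Finset (Fin n)) (r : ℕ) :
    ((N.card.choose r : ℕ) : ℝ) = ∑ A ∈ (Finset.univ : Finset (Fin n)).powersetCard r,
      ind (A ⊆ N) := by
  classical
  rw [← Finset.card_powersetCard]
  have : N.powersetCard r = (Finset.univ.powersetCard r).filter (fun A => A ⊆ N) := by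
    ext A
    simp only [Finset.mem_powersetCard, Finset.mem_filter, Finset.subset_univ, true_and]
    tauto
  rw [this, Finset.card_filter]
  push_cast
  simp only [ite_eq_ind]

theorem expect_choose_neverMoved {n k : ℕ} (hk : k ≤ n) (t r : ℕ) :
    𝔼 ω : Fin t → KSet n k, (((neverMoved ω).card.choose r : ℕ) : ℝ) =
      n.choose r * patternProb n k 0 r ^ t := by
  simp only [choose_card_eq_sum_ind, subset_neverMoved_iff]
  rw [Finset.expect_sum_comm, Finset.sum_congr rfl (g := fun _ => patternProb n k 0 r ^ t)]
  · rw [Finset.sum_const, Finset.card_powersetCard, Finset.card_univ, Fintype.card_fin,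
      nsmul_eq_mul]
  · intro A hA
    rw [expect_neverMoved hk, (Finset.mem_powersetCard.1 hA).2]

/-- The alternating sum of binomials detects `m = 0`. Absorption, `r C(m,r) = m C(m-1,r-1)`, reduces
the part weighted by `r` to the same sum for `m - 1`, which detects `m = 1`. -/
theorem sum_range_choose_eq_ind_le_one (m : ℕ) :
    ∑ r ∈ Finset.range (m + 1), (-1 : ℝ) ^ r * (1 - r) * m.choose r = ind (m ≤ 1) := by
  have halt : ∀ m : ℕ, ∑ r ∈ Finset.range (m + 1), (-1 : ℝ) ^ r * m.choose r =
      if m = 0 then 1 else 0 := fun m => by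
    have := Int.alternating_sum_range_choose (n := m)
    exact_mod_cast this
  have hsplit : ∀ m : ℕ, ∑ r ∈ Finset.range (m + 1), (-1 : ℝ) ^ r * (1 - r) * m.choose r =
      (if m = 0 then 1 else 0) -
        ∑ r ∈ Finset.range (m + 1), (-1 : ℝ) ^ r * (r * m.choose r) := fun m => by
    rw [← halt, ← Finset.sum_sub_distrib]
    exact Finset.sum_congr rfl fun r _ => by ring
  rw [hsplit]
  cases m with
  | zero => simp [ind]
  | succ m =>
    rw [Finset.sum_range_succ']
    have : ∀ r ∈ Finset.range (m + 1),
        (-1 : ℝ) ^ (r + 1) * (((r + 1 : ℕ) : ℝ) * ((m + 1).choose (r + 1) : ℕ)) =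
        -(m + 1) * ((-1) ^ r * m.choose r) := fun r _ => by
      have h := Nat.add_one_mul_choose_eq m r
      have h' : ((m : ℝ) + 1) * m.choose r = (m + 1).choose (r + 1) * (r + 1) := by
        exact_mod_cast h
      push_cast
      rw [mul_comm ((r : ℝ) + 1), ← h']
      ring
    rw [Finset.sum_congr rfl this, ← Finset.mul_sum, halt]
    by_cases hm : m = 0
    · subst hm; simp [ind]
    · rw [ind_of_not (by omega)]; simp [hm]

/-- The sum is finite, but writing it as a series over a range independent of `n` prepares for
dominated convergence. -/
theorem expect_ind_card_neverMoved_le_one {n k : ℕ} (hk : k ≤ n) (t : ℕ) :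
    𝔼 ω : Fin t → KSet n k, ind ((neverMoved ω).card ≤ 1) =
      ∑' r : ℕ, (-1 : ℝ) ^ r * (1 - r) * (n.choose r * patternProb n k 0 r ^ t) := by
  rw [tsum_eq_sum (s := Finset.range (n + 1)) fun r hr => by
    rw [Nat.choose_eq_zero_of_lt (by simpa using hr)]; simp]
  simp only [← expect_choose_neverMoved hk t, Finset.mul_expect]
  rw [← Finset.expect_sum_comm]
  refine Finset.expect_congr rfl fun ω _ => ?_
  rw [← sum_range_choose_eq_ind_le_one]
  refine Finset.sum_subset ?_ fun r _ hr => ?_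
  · have : (neverMoved ω).card ≤ n := by simpa using Finset.card_le_univ (neverMoved ω)
    exact Finset.range_mono (by omega)
  · rw [Nat.choose_eq_zero_of_lt (by simpa using hr)]; simp

theorem neverSplit_of_subset_neverMoved {n k t : ℕ} {ω : Fin t → KSet n k} {A : Finset (Fin n)}
    (h : A ⊆ neverMoved ω) : NeverSplit ω A :=
  fun s => Or.inr ((subset_neverMoved_iff ω A).1 h s)

theorem sepProb_le_expect_card_neverMoved (n k t : ℕ) :
    sepProb n k t ≤ 𝔼 ω : Fin t → KSet n k, ind ((neverMoved ω).card ≤ 1) := by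
  refine Finset.expect_le_expect fun ω _ => ind_mono fun h => ?_
  by_contra hN
  obtain ⟨p, hp, hp2⟩ := Finset.exists_subset_card_eq (s := neverMoved ω) (n := 2) (by omega)
  exact h p hp2 (neverSplit_of_subset_neverMoved hp)

/-- If at most one card is never moved and separation still fails, some unsplit pair contains a
moved card. The bound is the union bound over such pairs. -/
theorem expect_card_neverMoved_sub_sepProb_le {n k : ℕ} (hk : k ≤ n) (t : ℕ) :
    𝔼 ω : Fin t → KSet n k, ind ((neverMoved ω).card ≤ 1) - sepProb n k t ≤
      n.choose 2 * (pairAgreement n k ^ t - patternProb n k 0 2 ^ t) := by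
  have h1 : ∀ ω : Fin t → KSet n k, ind ((neverMoved ω).card ≤ 1) - ind (Separating ω) ≤
      ∑ p ∈ (Finset.univ : Finset (Fin n)).powersetCard 2,
        (ind (NeverSplit ω p) - ind (∀ s, Disjoint p (ω s).1)) := by
    intro ω
    have h0 : ∀ p ∈ (Finset.univ : Finset (Fin n)).powersetCard 2,
        0 ≤ ind (NeverSplit ω p) - ind (∀ s, Disjoint p (ω s).1) := fun p _ =>
      sub_nonneg.2 (ind_mono fun h s => Or.inr (h s))
    by_cases hs : Separating ω
    · rw [ind_of hs]
      linarith [ind_le_one ((neverMoved ω).card ≤ 1), Finset.sum_nonneg h0]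
    by_cases hN : (neverMoved ω).card ≤ 1
    · simp only [Separating, not_forall, not_not] at hs
      obtain ⟨p, hp, hps⟩ := hs
      refine le_trans ?_ (Finset.single_le_sum h0 (a := p)
        (Finset.mem_powersetCard.2 ⟨Finset.subset_univ _, hp⟩))
      have hz : ¬ ∀ s, Disjoint p (ω s).1 := fun hz => by
        have := Finset.card_le_card ((subset_neverMoved_iff ω p).2 hz)
        omega
      rw [ind_of hps, ind_of_not hz, ind_of hN]
      linarith [ind_nonneg (Separating ω)]
    · rw [ind_of_not hN]
      linarith [ind_nonneg (Separating ω), Finset.sum_nonneg h0]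
  rw [sepProb, ← Finset.expect_sub_distrib]
  refine (Finset.expect_le_expect fun ω _ => h1 ω).trans (le_of_eq ?_)
  rw [Finset.expect_sum_comm, Finset.sum_congr rfl
    (g := fun _ => pairAgreement n k ^ t - patternProb n k 0 2 ^ t)]
  · rw [Finset.sum_const, Finset.card_powersetCard, Finset.card_univ, Fintype.card_fin,
      nsmul_eq_mul]
  · intro p hp
    have hp2 := (Finset.mem_powersetCard.1 hp).2
    rw [Finset.expect_sub_distrib, expect_neverMoved hk,
      expect_neverSplit hk t (Finset.card_pos.1 (by omega)), hp2, pairAgreement_eq]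

/-! ### Limits in the sparse regime -/

theorem choose_mul_patternProb_pow (n k r t : ℕ) :
    (n.choose r : ℝ) * patternProb n k 0 r ^ t = (1 / r.factorial) *
      ∏ i ∈ Finset.range r, (((n - i : ℕ) : ℝ) * (((n - k - i : ℕ) : ℝ) / ((n - i : ℕ) : ℝ)) ^ t) := by
  have h : ((n.choose r : ℕ) : ℝ) = (1 / r.factorial) * ∏ i ∈ Finset.range r, ((n - i : ℕ) : ℝ) := by
    have := Nat.descFactorial_eq_factorial_mul_choose n r
    rw [Nat.descFactorial_eq_prod_range] at this
    rw [← Nat.cast_prod, this]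
    push_cast
    field_simp
  rw [h, patternProb, Finset.prod_mul_distrib, Finset.prod_pow, Finset.prod_div_distrib]
  simp only [zero_add, Nat.descFactorial_eq_prod_range, Nat.cast_one,
    one_mul, Nat.cast_prod, mul_assoc, Finset.range_zero, Finset.prod_empty]

/-- Both the prefactor and the ratio decrease in `i`, so the factor at `i = 0` dominates; this
bound, uniform in `i`, provides the dominating series. -/
theorem sub_mul_ratio_pow_le {n k : ℕ} (hk : k ≤ n) (i t : ℕ) :
    ((n - i : ℕ) : ℝ) * (((n - k - i : ℕ) : ℝ) / ((n - i : ℕ) : ℝ)) ^ t ≤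
      n * (1 - (k : ℝ) / n) ^ t := by
  have hle : ((n - i : ℕ) : ℝ) ≤ n := by exact_mod_cast Nat.sub_le n i
  by_cases hi : n ≤ i
  · rw [Nat.sub_eq_zero_of_le hi]
    simp only [Nat.cast_zero, zero_mul]
    have : (k : ℝ) / n ≤ 1 := div_le_one_of_le₀ (by exact_mod_cast hk) (by positivity)
    exact mul_nonneg (by positivity) (pow_nonneg (by linarith) _)
  · push Not at hi
    have hn : (0 : ℝ) < n := by exact_mod_cast (by omega : 0 < n)
    have hni : (0 : ℝ) < ((n - i : ℕ) : ℝ) := by exact_mod_cast (by omega : 0 < n - i)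
    gcongr
    rw [div_le_iff₀ hni]
    by_cases h : n - k ≤ i
    · rw [Nat.sub_eq_zero_of_le h, Nat.cast_zero]
      have : (k : ℝ) / n ≤ 1 := div_le_one_of_le₀ (by exact_mod_cast hk) (by positivity)
      exact mul_nonneg (by linarith) hni.le
    · rw [Nat.cast_sub (by omega), Nat.cast_sub hk, Nat.cast_sub hi.le]
      have : (1 - (k : ℝ) / n) * (n - i) = n - k - i + k * i / n := by field_simp; ring
      rw [this]
      have : (0 : ℝ) ≤ k * i / n := by positivity
      linarith

/-- This evaluates, from its binomial moments `x^r/r!`, the probability that a Poisson variable of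
mean `x` is at most one. -/
theorem tsum_poisson_le_one (x : ℝ) :
    ∑' r : ℕ, (-1 : ℝ) ^ r * (1 - r) * (1 / r.factorial * x ^ r) = Real.exp (-x) * (1 + x) := by
  have h1 : HasSum (fun r : ℕ => (-x) ^ r / r.factorial) (Real.exp (-x)) := by
    rw [Real.exp_eq_exp_ℝ]; exact NormedSpace.expSeries_div_hasSum_exp (-x)
  have h2 : HasSum (fun r : ℕ => (r : ℝ) * ((-x) ^ r / r.factorial)) (-x * Real.exp (-x)) := by
    rw [← hasSum_nat_add_iff' 1]
    simp only [Finset.range_one, Finset.sum_singleton, Nat.cast_zero, zero_mul, sub_zero]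
    refine (h1.mul_left (-x)).congr_fun fun r => ?_
    rw [Nat.factorial_succ, pow_succ]
    push_cast
    field_simp
  rw [show Real.exp (-x) * (1 + x) = Real.exp (-x) - -x * Real.exp (-x) by ring]
  refine ((h1.sub h2).congr_fun fun r => ?_).tsum_eq
  rw [neg_pow]
  ring

theorem tendsto_ratio_of_mul_log {k : ℕ → ℕ}
    (hs : Tendsto (fun n : ℕ => (k n : ℝ) * Real.log n / n) atTop (𝓝 0)) :
    Tendsto (fun n : ℕ => (k n : ℝ) / n) atTop (𝓝 0) := by
  refine squeeze_zero' (Eventually.of_forall fun n => by positivity) ?_ hs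
  have hlog := (Real.tendsto_log_atTop.comp tendsto_natCast_atTop_atTop).eventually_ge_atTop 1
  filter_upwards [hlog] with n hn
  gcongr
  exact le_mul_of_one_le_right (Nat.cast_nonneg _) hn

/-- The floor changes the product by at most `k/n`, which tends to `0`. -/
theorem tendsto_floor_mul_ratio_sub_log {k : ℕ → ℕ} (hk : ∀ᶠ n : ℕ in atTop, 1 ≤ k n ∧ k n ≤ n)
    (hs : Tendsto (fun n : ℕ => (k n : ℝ) * Real.log n / n) atTop (𝓝 0)) (c : ℝ) :
    Tendsto (fun n : ℕ => (⌊(n : ℝ) / (k n : ℝ) * (Real.log n + c)⌋₊ : ℝ) * (k n / n)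
      - Real.log n) atTop (𝓝 c) := by
  have h0 := tendsto_ratio_of_mul_log hs
  have hlog := (Real.tendsto_log_atTop.comp tendsto_natCast_atTop_atTop).eventually_ge_atTop (-c)
  have hlow : Tendsto (fun n : ℕ => c - (k n : ℝ) / n) atTop (𝓝 c) := by
    simpa using tendsto_const_nhds.sub h0
  refine tendsto_of_tendsto_of_tendsto_of_le_of_le' hlow tendsto_const_nhds ?_ ?_
  all_goals
    filter_upwards [hk, hlog] with n hn hl
    have hkp : (0 : ℝ) < k n := by exact_mod_cast hn.1
    have hnp : (0 : ℝ) < n := by exact_mod_cast (by omega : 0 < n)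
    have hl' : 0 ≤ Real.log n + c := by simp only [Function.comp] at hl; linarith
    have hx : 0 ≤ (n : ℝ) / (k n : ℝ) * (Real.log n + c) := by positivity
    have e : (n : ℝ) / (k n : ℝ) * (Real.log n + c) * (k n / n) = Real.log n + c := by
      field_simp
    have hr : (0 : ℝ) < k n / n := by positivity
  · have := mul_le_mul_of_nonneg_right
      (Nat.lt_floor_add_one ((n : ℝ) / (k n : ℝ) * (Real.log n + c))).le hr.le
    rw [e, add_mul] at this
    linarith
  · have := mul_le_mul_of_nonneg_right (Nat.floor_le hx) hr.le
    rw [e] at this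
    linarith

section SparseAsymptotics

variable {k t : ℕ → ℕ} {c : ℝ} (hk : ∀ᶠ n : ℕ in atTop, 1 ≤ k n ∧ k n ≤ n)
  (hs : Tendsto (fun n : ℕ => (k n : ℝ) * Real.log n / n) atTop (𝓝 0))
  (ht : Tendsto (fun n : ℕ => (t n : ℝ) * (k n / n) - Real.log n) atTop (𝓝 c))

include hs in
theorem eventually_mul_le_of_mul_log (m : ℕ) : ∀ᶠ n : ℕ in atTop, m * k n ≤ n := by
  have h := (tendsto_ratio_of_mul_log hs).eventually_le_const
    (show (0 : ℝ) < 1 / (m + 1) by positivity)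
  filter_upwards [h, eventually_gt_atTop 0] with n hn hn0
  have hnp : (0 : ℝ) < n := by exact_mod_cast hn0
  rw [div_le_div_iff₀ hnp (by positivity)] at hn
  have : (m : ℝ) * k n ≤ n := by nlinarith [(Nat.cast_nonneg (k n) : (0 : ℝ) ≤ k n)]
  exact_mod_cast this

include hs ht in
theorem tendsto_time_mul_ratio_sq :
    Tendsto (fun n : ℕ => (t n : ℝ) * (k n / n) * (k n / n)) atTop (𝓝 0) := by
  have h := (ht.mul (tendsto_ratio_of_mul_log hs)).add hs
  simp only [mul_zero, add_zero] at h
  refine h.congr fun n => ?_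
  ring

include hk hs ht in
-- Sandwich by `1 - 1/x ≤ log x ≤ x - 1`; the two bounds differ by a multiple of `t (k/n)^2`, which
-- is negligible.
theorem tendsto_log_add_mul_log_one_sub (i : ℕ) :
    Tendsto (fun n : ℕ => Real.log n + t n * Real.log (1 - k n / ((n : ℝ) - i))) atTop
      (𝓝 (-c)) := by
  have h0 := tendsto_ratio_of_mul_log hs
  have hi0 : Tendsto (fun n : ℕ => (i : ℝ) / n) atTop (𝓝 0) :=
    tendsto_const_div_atTop_nhds_zero_nat _
  have hup : Tendsto (fun n : ℕ => Real.log n - t n * (k n / n)) atTop (𝓝 (-c)) := by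
    refine ht.neg.congr fun n => ?_
    ring
  have hlow : Tendsto (fun n : ℕ => Real.log n - t n * (k n / n) -
      (i + 1) * (t n * (k n / n) * (k n / n)) / (1 - i / n - k n / n)) atTop (𝓝 (-c)) := by
    have h1 : Tendsto (fun n : ℕ => 1 - (i : ℝ) / n - k n / n) atTop (𝓝 1) := by
      simpa using (tendsto_const_nhds.sub hi0).sub h0
    have h2 := ((tendsto_time_mul_ratio_sq hs ht).const_mul ((i : ℝ) + 1)).div h1 one_ne_zero
    simpa using hup.sub h2
  refine tendsto_of_tendsto_of_tendsto_of_le_of_le' hlow hup ?_ ?_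
  all_goals
    filter_upwards [hk, eventually_mul_le_of_mul_log hs 2, eventually_gt_atTop (2 * i)]
      with n hn hn2 hni
    have hkp : (1 : ℝ) ≤ k n := by exact_mod_cast hn.1
    have hnp : (0 : ℝ) < n := by exact_mod_cast (by omega : 0 < n)
    have hik : (0 : ℝ) < n - i - k n := by
      have : ((i + k n : ℕ) : ℝ) < n := by exact_mod_cast (by omega : i + k n < n)
      push_cast at this
      linarith
    have hi1 : (0 : ℝ) < n - i := by linarith
    have hpos : 0 < 1 - (k n : ℝ) / ((n : ℝ) - i) := by
      rw [sub_pos, div_lt_one hi1]; linarith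
  · have hl := Real.one_sub_inv_le_log_of_pos hpos
    have e : 1 - (1 - (k n : ℝ) / ((n : ℝ) - i))⁻¹ = -(k n / (n - i - k n)) := by
      have : (1 - (k n : ℝ) / ((n : ℝ) - i)) = (n - i - k n) / (n - i) := by field_simp
      rw [this, inv_div, eq_neg_iff_add_eq_zero]
      field_simp
      ring
    rw [e] at hl
    have h3 := mul_le_mul_of_nonneg_left hl (Nat.cast_nonneg (t n) : (0 : ℝ) ≤ t n)
    have h4 : (t n : ℝ) * (k n / (n - i - k n)) ≤ t n * (k n / n) +
        (i + 1) * (t n * (k n / n) * (k n / n)) / (1 - i / n - k n / n) := by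
      have e2 : (1 - (i : ℝ) / n - k n / n) = (n - i - k n) / n := by field_simp
      have e3 : t n * ((k n : ℝ) / n) +
        (i + 1) * (t n * (k n / n) * (k n / n)) / (1 - i / n - k n / n) =
        t n * (k n / (n - i - k n)) * ((n - i - k n + (i + 1) * k n) / n) := by
        rw [e2]; field_simp
      rw [e3]
      -- The last factor equals `(n + i(k-1))/n`, which is at least `1` because `1 ≤ k`; this is why
      -- the constant is `i + 1`.
      refine le_mul_of_one_le_right (by positivity) ?_
      rw [one_le_div hnp]
      nlinarith [(Nat.cast_nonneg i : (0 : ℝ) ≤ i)]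
    linarith
  · have hl := Real.log_le_sub_one_of_pos hpos
    have h5 : (k n : ℝ) / n ≤ k n / (n - i) := by
      gcongr
      linarith [(Nat.cast_nonneg i : (0 : ℝ) ≤ i)]
    have h3 := mul_le_mul_of_nonneg_left (hl.trans (by linarith : _ ≤ -((k n : ℝ) / n)))
      (Nat.cast_nonneg (t n) : (0 : ℝ) ≤ t n)
    linarith

include hk hs ht in
theorem tendsto_sub_mul_ratio_pow (i : ℕ) :
    Tendsto (fun n : ℕ => ((n - i : ℕ) : ℝ) *
      (((n - k n - i : ℕ) : ℝ) / ((n - i : ℕ) : ℝ)) ^ t n) atTop (𝓝 (Real.exp (-c))) := by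
  have h1 : Tendsto (fun n : ℕ => 1 - (i : ℝ) / n) atTop (𝓝 1) := by
    simpa using tendsto_const_nhds.sub (tendsto_const_div_atTop_nhds_zero_nat (i : ℝ))
  have h2 := h1.mul ((Real.continuous_exp.tendsto _).comp
    (tendsto_log_add_mul_log_one_sub hk hs ht i))
  rw [one_mul] at h2
  refine h2.congr' ?_
  filter_upwards [hk, eventually_mul_le_of_mul_log hs 2, eventually_gt_atTop (2 * i)]
    with n hn hn2 hni
  have hnp : (0 : ℝ) < n := by exact_mod_cast (by omega : 0 < n)
  have hik : (0 : ℝ) < n - i - k n := by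
    have : ((i + k n : ℕ) : ℝ) < n := by exact_mod_cast (by omega : i + k n < n)
    push_cast at this
    linarith
  have hi1 : (0 : ℝ) < n - i := by linarith [(Nat.cast_nonneg (k n) : (0 : ℝ) ≤ k n)]
  have hpos : 0 < 1 - (k n : ℝ) / ((n : ℝ) - i) := by
    rw [sub_pos, div_lt_one hi1]; linarith
  have e : (((n - k n - i : ℕ) : ℝ) / ((n - i : ℕ) : ℝ)) = 1 - (k n : ℝ) / ((n : ℝ) - i) := by
    rw [Nat.cast_sub (by omega), Nat.cast_sub hn.2, Nat.cast_sub (by omega)]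
    field_simp
    ring
  rw [e, Nat.cast_sub (by omega)]
  simp only [Function.comp]
  rw [Real.exp_add, Real.exp_log hnp, ← Real.rpow_natCast, Real.rpow_def_of_pos hpos,
    mul_comm (Real.log _)]
  field_simp

include hk hs ht in
theorem tendsto_choose_mul_patternProb_pow (r : ℕ) :
    Tendsto (fun n : ℕ => (n.choose r : ℝ) * patternProb n (k n) 0 r ^ t n) atTop
      (𝓝 (1 / r.factorial * Real.exp (-c) ^ r)) := by
  simp only [choose_mul_patternProb_pow]
  have h := (tendsto_finsetProd (Finset.range r) fun i _ =>
    tendsto_sub_mul_ratio_pow hk hs ht i).const_mul (1 / (r.factorial : ℝ))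
  simpa only [Finset.prod_const, Finset.card_range] using h

include hk hs ht in
theorem tendsto_expect_ind_card_neverMoved_le_one :
    Tendsto (fun n : ℕ => 𝔼 ω : Fin (t n) → KSet n (k n), ind ((neverMoved ω).card ≤ 1)) atTop
      (𝓝 (Real.exp (-Real.exp (-c)) * (1 + Real.exp (-c)))) := by
  rw [← tsum_poisson_le_one]
  -- The factor with `i = 0` converges to `e^{-c}`, so it is eventually below `e^{-c} + 1`; the
  -- series with terms `(r+1) M^r / r!` then dominates.
  have hM : ∀ᶠ n : ℕ in atTop, (n : ℝ) * (1 - (k n : ℝ) / n) ^ t n ≤ Real.exp (-c) + 1 := by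
    have h := tendsto_sub_mul_ratio_pow hk hs ht 0
    filter_upwards [h.eventually_le_const (lt_add_one _), hk] with n hn hkn
    have hnp : (n : ℝ) ≠ 0 := by exact_mod_cast (by omega : n ≠ 0)
    rw [one_sub_div hnp]
    simpa [Nat.cast_sub hkn.2] using hn
  set M := Real.exp (-c) + 1 with hMdef
  have hMpos : 0 < M := by positivity
  have hbound : Summable fun r : ℕ => ((r : ℝ) + 1) * (M ^ r / r.factorial) := by
    have h1 := Real.summable_pow_div_factorial M
    have h2 : Summable fun r : ℕ => (r : ℝ) * (M ^ r / r.factorial) := by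
      rw [← summable_nat_add_iff 1]
      refine (h1.mul_left M).congr fun r => ?_
      rw [Nat.factorial_succ, pow_succ]
      push_cast
      field_simp
    refine (h2.add h1).congr fun r => ?_
    ring
  have hmain := tendsto_tsum_of_dominated_convergence (𝓕 := atTop) hbound
    (f := fun (n : ℕ) (r : ℕ) => (-1 : ℝ) ^ r * (1 - r) *
      (n.choose r * patternProb n (k n) 0 r ^ t n))
    (g := fun r : ℕ => (-1 : ℝ) ^ r * (1 - r) * (1 / r.factorial * Real.exp (-c) ^ r))
    (fun r => (tendsto_choose_mul_patternProb_pow hk hs ht r).const_mul _) (by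
      filter_upwards [hM, hk] with n hn hkn r
      rw [norm_mul, norm_mul, norm_pow, norm_neg, norm_one, one_pow, one_mul]
      refine mul_le_mul ?_ ?_ (norm_nonneg _) (by positivity)
      · rw [Real.norm_eq_abs, abs_le]
        constructor <;> linarith [(Nat.cast_nonneg r : (0 : ℝ) ≤ r)]
      · rw [Real.norm_of_nonneg (mul_nonneg (Nat.cast_nonneg _)
          (pow_nonneg (patternProb_nonneg _ _ _ _) _)), choose_mul_patternProb_pow,
          one_div, div_eq_inv_mul (M ^ r)]
        refine mul_le_mul_of_nonneg_left ?_ (by positivity)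
        refine (Finset.prod_le_prod (g := fun _ => M) (fun i _ => by positivity) fun i _ =>
          (sub_mul_ratio_pow_le hkn.2 i _).trans hn).trans ?_
        simp)
  refine hmain.congr' ?_
  filter_upwards [hk] with n hn
  rw [expect_ind_card_neverMoved_le_one hn.2]

/-- Compare `k(k-1) ≤ k^2` with `(n-k)(n-k-1) ≥ (n/2)^2`. Taking both cards is thus rarer than
taking neither by a factor of order `(k/n)^2`. -/
theorem patternProb_two_zero_le {n k : ℕ} (hk : 2 * k + 4 ≤ n) :
    patternProb n k 2 0 ≤ patternProb n k 0 2 * (4 * (k / n) * (k / n)) := by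
  have e : ∀ m : ℕ, 1 ≤ m → (m.descFactorial 2 : ℝ) = m * (m - 1) := fun m hm => by
    simp [Nat.descFactorial, Nat.cast_sub hm, mul_comm]
  rcases Nat.eq_zero_or_pos k with rfl | hk0
  · simp [patternProb]
  simp only [patternProb, Nat.descFactorial_zero, Nat.cast_one, mul_one, one_mul, add_zero,
    zero_add]
  rw [e n (by omega), e k hk0, e (n - k) (by omega), Nat.cast_sub (by omega), div_mul_eq_mul_div]
  have hkp : (1 : ℝ) ≤ k := by exact_mod_cast hk0
  have hnk : (2 : ℝ) * k + 4 ≤ n := by exact_mod_cast hk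
  have hnp : (0 : ℝ) < n := by linarith
  refine div_le_div_of_nonneg_right ?_ (by nlinarith)
  have h1 : (n : ℝ) / 2 ≤ n - k := by linarith
  have h4 : ((n : ℝ) - k) * (n - k - 1) ≥ n / 2 * (n / 2) := by nlinarith
  calc (k : ℝ) * (k - 1) ≤ k * k := by nlinarith
    _ = n / 2 * (n / 2) * (4 * (k / n) * (k / n)) := by field_simp; ring
    _ ≤ _ := mul_le_mul_of_nonneg_right h4 (by positivity)

include hk hs ht in
theorem tendsto_sepProb_sparse :
    Tendsto (fun n : ℕ => sepProb n (k n) (t n)) atTop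
      (𝓝 (Real.exp (-Real.exp (-c)) * (1 + Real.exp (-c)))) := by
  have hN := tendsto_expect_ind_card_neverMoved_le_one hk hs ht
  have herr : Tendsto (fun n : ℕ => (n.choose 2 : ℝ) * patternProb n (k n) 0 2 ^ t n *
      (Real.exp (4 * (t n * (k n / n) * (k n / n))) - 1)) atTop (𝓝 0) := by
    have h1 := tendsto_choose_mul_patternProb_pow hk hs ht 2
    have h2 := (Real.continuous_exp.tendsto _).comp
      ((tendsto_time_mul_ratio_sq hs ht).const_mul 4)
    have h3 := h1.mul (h2.sub_const 1)
    simpa using h3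
  have hlow := hN.sub herr
  rw [sub_zero] at hlow
  refine tendsto_of_tendsto_of_tendsto_of_le_of_le' hlow hN ?_
    (Eventually.of_forall fun n => sepProb_le_expect_card_neverMoved _ _ _)
  -- Together `4k ≤ n` and `8 ≤ n` give `2k + 4 ≤ n`.
  filter_upwards [hk, eventually_mul_le_of_mul_log hs 4, eventually_ge_atTop 8] with n hn hn4 hn8
  have h := expect_card_neverMoved_sub_sepProb_le hn.2 (t n)
  refine sub_le_comm.1 (h.trans ?_)
  rw [mul_assoc]
  refine mul_le_mul_of_nonneg_left ?_ (Nat.cast_nonneg _)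
  have h2 : pairAgreement n (k n) ≤
      patternProb n (k n) 0 2 * Real.exp (4 * (k n / n) * (k n / n)) := by
    rw [pairAgreement_eq]
    have h3 := patternProb_two_zero_le (n := n) (k := k n) (by omega)
    have h4 := mul_le_mul_of_nonneg_left (Real.add_one_le_exp (4 * ((k n : ℝ) / n) * (k n / n)))
      (patternProb_nonneg n (k n) 0 2)
    linarith
  have h5 := pow_le_pow_left₀ (pairAgreement_nonneg _ _) h2 (t n)
  rw [mul_pow, ← Real.exp_nat_mul] at h5
  rw [mul_sub, mul_one]
  have e : (t n : ℝ) * (4 * (k n / n) * (k n / n)) = 4 * (t n * (k n / n) * (k n / n)) := by ring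
  rw [e] at h5
  linarith

end SparseAsymptotics

/-! ### Unsplit pairs and triples: moments -/

open Classical in
/-- The sets of `r` cards that no move of `ω` splits. -/
noncomputable def unsplitSets {n k t : ℕ} (r : ℕ) (ω : Fin t → KSet n k) :
    Finset (Finset (Fin n)) :=
  ((Finset.univ : Finset (Fin n)).powersetCard r).filter (NeverSplit ω)

theorem mem_unsplitSets {n k t r : ℕ} {ω : Fin t → KSet n k} {A : Finset (Fin n)} :
    A ∈ unsplitSets r ω ↔ A.card = r ∧ NeverSplit ω A := by
  simp [unsplitSets]

/-- The probability that `r` given cards stay together under one move, if `0 < r`. -/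
noncomputable def blockProb (n k r : ℕ) : ℝ := patternProb n k r 0 + patternProb n k 0 r

theorem blockProb_nonneg (n k r : ℕ) : 0 ≤ blockProb n k r :=
  add_nonneg (patternProb_nonneg _ _ _ _) (patternProb_nonneg _ _ _ _)

theorem expect_card_unsplitSets {n k : ℕ} (hk : k ≤ n) (t : ℕ) {r : ℕ} (hr : 0 < r) :
    𝔼 ω : Fin t → KSet n k, ((unsplitSets r ω).card : ℝ) = n.choose r * blockProb n k r ^ t := by
  have h : ∀ ω : Fin t → KSet n k, ((unsplitSets r ω).card : ℝ) =
      ∑ A ∈ (Finset.univ : Finset (Fin n)).powersetCard r, ind (NeverSplit ω A) := fun ω => by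
    rw [unsplitSets, Finset.card_filter]
    push_cast
    simp only [ite_eq_ind]
  simp only [h]
  rw [Finset.expect_sum_comm, Finset.sum_congr rfl (g := fun _ => blockProb n k r ^ t)]
  · rw [Finset.sum_const, Finset.card_powersetCard, Finset.card_univ, Fintype.card_fin,
      nsmul_eq_mul]
  · intro A hA
    have hA2 := (Finset.mem_powersetCard.1 hA).2
    rw [expect_neverSplit hk t (Finset.card_pos.1 (hA2 ▸ hr)), hA2, blockProb]

theorem Unsplit.union {n : ℕ} {S A B : Finset (Fin n)} (hA : Unsplit S A) (hB : Unsplit S B)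
    (h : ¬ Disjoint A B) : Unsplit S (A ∪ B) := by
  obtain ⟨x, hxA, hxB⟩ := Finset.not_disjoint_iff.1 h
  rcases hA with hA | hA <;> rcases hB with hB | hB
  · exact Or.inl (Finset.union_subset hA hB)
  · exact absurd (hA hxA) (Finset.disjoint_left.1 hB hxB)
  · exact absurd (hB hxB) (Finset.disjoint_left.1 hA hxA)
  · exact Or.inr (Finset.disjoint_union_left.2 ⟨hA, hB⟩)

/-- Two distinct pairs that meet share exactly one card, and a move treats both pairs as it treats
that card. -/
theorem union_mem_unsplitSets {n k t : ℕ} {ω : Fin t → KSet n k} {p q : Finset (Fin n)}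
    (hp : p ∈ unsplitSets 2 ω) (hq : q ∈ unsplitSets 2 ω) (hpq : p ≠ q) (h : ¬ Disjoint p q) :
    p ∪ q ∈ unsplitSets 3 ω := by
  rw [mem_unsplitSets] at *
  refine ⟨?_, fun s => (hp.2 s).union (hq.2 s) h⟩
  have h1 := Finset.card_union_add_card_inter p q
  have h2 : 0 < (p ∩ q).card := Finset.card_pos.2 (Finset.not_disjoint_iff_nonempty_inter.1 h)
  have h3 : (p ∩ q).card < 2 := by
    by_contra h3
    have e1 := Finset.eq_of_subset_of_card_le (Finset.inter_subset_left (s₁ := p) (s₂ := q))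
      (by omega)
    have e2 := Finset.eq_of_subset_of_card_le (Finset.inter_subset_right (s₁ := p) (s₂ := q))
      (by omega)
    exact hpq (e1.symm.trans e2)
  omega

theorem pairwiseDisjoint_unsplitSets {n k t : ℕ} {ω : Fin t → KSet n k}
    (h : (unsplitSets 3 ω).card = 0) :
    (unsplitSets 2 ω : Set (Finset (Fin n))).PairwiseDisjoint id := by
  intro p hp q hq hpq
  by_contra hd
  have := union_mem_unsplitSets hp hq hpq hd
  rw [Finset.card_eq_zero.1 h] at this
  simp at this

/-- Ordered couples of unsplit pairs are equal, overlapping or disjoint. An overlapping couple lies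
in the unsplit triple that is its union, and a triple contains `3 * 3 = 9` couples of pairs. -/
theorem card_unsplitSets_two_sq_le {n k t : ℕ} (ω : Fin t → KSet n k) :
    ((unsplitSets 2 ω).card : ℝ) ^ 2 ≤ (unsplitSets 2 ω).card + 9 * (unsplitSets 3 ω).card +
      ∑ x ∈ ((Finset.univ : Finset (Fin n)).powersetCard 2 ×ˢ
        (Finset.univ : Finset (Fin n)).powersetCard 2).filter (fun x => Disjoint x.1 x.2),
        ind (∀ p ∈ ({x.1, x.2} : Finset (Finset (Fin n))), NeverSplit ω p) := by
  classical
  set P := unsplitSets 2 ω with hP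
  have hsub : P ×ˢ P ⊆ P.diag ∪
      (P ×ˢ P).filter (fun x => x.1 ≠ x.2 ∧ ¬ Disjoint x.1 x.2) ∪
      (((Finset.univ : Finset (Fin n)).powersetCard 2 ×ˢ
        (Finset.univ : Finset (Fin n)).powersetCard 2).filter (fun x => Disjoint x.1 x.2)).filter
        (fun x => ∀ p ∈ ({x.1, x.2} : Finset (Finset (Fin n))), NeverSplit ω p) := by
    intro x hx
    have hx' := Finset.mem_product.1 hx
    have h1 := mem_unsplitSets.1 hx'.1
    have h2 := mem_unsplitSets.1 hx'.2
    simp only [Finset.mem_union, Finset.mem_diag, Finset.mem_filter, hx, Finset.mem_product,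
      Finset.mem_powersetCard, Finset.subset_univ, true_and, h1.1, h2.1, Finset.mem_insert,
      Finset.mem_singleton, forall_eq_or_imp, forall_eq, h1.2, h2.2, and_true, hx'.1]
    tauto
  have hmid : ((P ×ˢ P).filter (fun x => x.1 ≠ x.2 ∧ ¬ Disjoint x.1 x.2)).card ≤
      9 * (unsplitSets 3 ω).card := by
    refine Finset.card_le_mul_card_image_of_maps_to (f := fun x => x.1 ∪ x.2) ?_ 9 ?_
    · intro x hx
      rw [Finset.mem_filter, Finset.mem_product] at hx
      exact union_mem_unsplitSets hx.1.1 hx.1.2 hx.2.1 hx.2.2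
    · intro T hT
      have hT3 := (mem_unsplitSets.1 hT).1
      have : (T.powersetCard 2 ×ˢ T.powersetCard 2).card = 9 := by
        rw [Finset.card_product, Finset.card_powersetCard, hT3]; rfl
      rw [← this]
      refine Finset.card_le_card fun x hx => ?_
      rw [Finset.mem_filter, Finset.mem_filter, Finset.mem_product] at hx
      obtain ⟨⟨⟨h1, h2⟩, -⟩, rfl⟩ := hx
      rw [Finset.mem_product, Finset.mem_powersetCard, Finset.mem_powersetCard]
      exact ⟨⟨Finset.subset_union_left, (mem_unsplitSets.1 h1).1⟩,
        ⟨Finset.subset_union_right, (mem_unsplitSets.1 h2).1⟩⟩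
  have hcard := (Finset.card_le_card hsub).trans ((Finset.card_union_le _ _).trans
    (Nat.add_le_add_right (Finset.card_union_le _ _) _))
  rw [Finset.card_product, Finset.diag_card, Finset.card_filter (fun x => ∀ p ∈ _, _)] at hcard
  have hfin := hcard.trans (Nat.add_le_add_right (Nat.add_le_add_left hmid _) _)
  have hreal : ((P.card * P.card : ℕ) : ℝ) ≤ _ := Nat.cast_le.2 hfin
  push_cast at hreal
  simp only [ite_eq_ind] at hreal
  rw [sq]
  exact hreal

theorem expect_card_unsplitSets_two_sq_le {n k : ℕ} (hk : k ≤ n) (t : ℕ) :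
    𝔼 ω : Fin t → KSet n k, ((unsplitSets 2 ω).card : ℝ) ^ 2 ≤
      n.choose 2 * blockProb n k 2 ^ t + 9 * (n.choose 3 * blockProb n k 3 ^ t) +
      (n.choose 2 : ℝ) ^ 2 * pairsProb n k 2 ^ t := by
  refine (Finset.expect_le_expect fun ω _ => card_unsplitSets_two_sq_le ω).trans ?_
  rw [Finset.expect_add_distrib, Finset.expect_add_distrib, ← Finset.mul_expect,
    expect_card_unsplitSets hk t two_pos, expect_card_unsplitSets hk t three_pos,
    Finset.expect_sum_comm]
  refine add_le_add_right ?_ _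
  rw [Finset.sum_congr rfl (g := fun _ => pairsProb n k 2 ^ t)]
  · rw [Finset.sum_const, nsmul_eq_mul]
    refine mul_le_mul_of_nonneg_right ?_ (pow_nonneg (pairsProb_nonneg _ _ _) _)
    have := Finset.card_filter_le ((Finset.univ : Finset (Fin n)).powersetCard 2 ×ˢ
        (Finset.univ : Finset (Fin n)).powersetCard 2) (fun x => Disjoint x.1 x.2)
    rw [Finset.card_product, Finset.card_powersetCard, Finset.card_univ, Fintype.card_fin,
      ← sq] at this
    exact_mod_cast this
  · rintro ⟨p, q⟩ hx
    simp only [Finset.mem_filter, Finset.mem_product, Finset.mem_powersetCard] at hx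
    obtain ⟨⟨⟨-, hp⟩, -, hq⟩, hd⟩ := hx
    have hne : p ≠ q := by
      rintro rfl
      rw [disjoint_self] at hd
      simp [hd] at hp
    rw [expect_neverSplit_pairs hk t (J := {p, q}), Finset.card_pair hne]
    · simp [hp, hq]
    · intro a ha b hb hab
      simp only [Finset.coe_insert, Finset.coe_singleton, Set.mem_insert_iff,
        Set.mem_singleton_iff] at ha hb
      rcases ha with rfl | rfl <;> rcases hb with rfl | rfl
      · exact absurd rfl hab
      · exact hd
      · exact hd.symm
      · exact absurd rfl hab

/-! ### Conditioning on the moves before the last few -/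

/-- The probability that `t` moves split each of `m` disjoint pairs of cards. -/
noncomputable def allSplitProb (n k t m : ℕ) : ℝ :=
  ∑ j ∈ Finset.range (m + 1), (m.choose j : ℝ) * ((-1) ^ j * pairsProb n k j ^ t)

theorem expect_forall_not_neverSplit {n k : ℕ} (hk : k ≤ n) (t : ℕ)
    {J : Finset (Finset (Fin n))} (hJ : ∀ p ∈ J, p.card = 2)
    (hd : (J : Set (Finset (Fin n))).PairwiseDisjoint id) :
    𝔼 ω : Fin t → KSet n k, ind (∀ p ∈ J, ¬ NeverSplit ω p) = allSplitProb n k t J.card := by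
  have h : ∀ ω : Fin t → KSet n k, ind (∀ p ∈ J, ¬ NeverSplit ω p) =
      ∑ I ∈ J.powerset, (-1) ^ I.card * ind (∀ p ∈ I, NeverSplit ω p) := fun ω => by
    rw [← prod_ind, Finset.prod_congr rfl fun p _ =>
      (ind_not (NeverSplit ω p)).trans (sub_eq_neg_add _ _), Finset.prod_add]
    refine Finset.sum_congr rfl fun I _ => ?_
    rw [Finset.prod_const_one, mul_one, Finset.prod_neg, prod_ind]
  simp only [h]
  rw [Finset.expect_sum_comm, Finset.sum_congr rfl
    (g := fun I => (-1) ^ I.card * pairsProb n k I.card ^ t),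
    Finset.sum_powerset_apply_card (fun j => (-1) ^ j * pairsProb n k j ^ t)]
  · simp only [nsmul_eq_mul, allSplitProb]
  · intro I hI
    rw [Finset.mem_powerset] at hI
    rw [← Finset.mul_expect, expect_neverSplit_pairs hk t (fun p hp => hJ p (hI hp))
      (hd.subset (by exact_mod_cast hI))]

theorem neverSplit_append_iff {n k u v : ℕ} (ω₁ : Fin u → KSet n k) (ω₂ : Fin v → KSet n k)
    (A : Finset (Fin n)) :
    NeverSplit (Fin.append ω₁ ω₂) A ↔ NeverSplit ω₁ A ∧ NeverSplit ω₂ A := by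
  refine ⟨fun h => ⟨fun s => ?_, fun s => ?_⟩, fun h s => ?_⟩
  · simpa using h (Fin.castAdd v s)
  · simpa using h (Fin.natAdd u s)
  · refine Fin.addCases (fun i => ?_) (fun i => ?_) s
    · simpa using h.1 i
    · simpa using h.2 i

theorem separating_append_iff {n k u v : ℕ} (ω₁ : Fin u → KSet n k) (ω₂ : Fin v → KSet n k) :
    Separating (Fin.append ω₁ ω₂) ↔ ∀ p ∈ unsplitSets 2 ω₁, ¬ NeverSplit ω₂ p := by
  simp only [Separating, neverSplit_append_iff, mem_unsplitSets]
  tauto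

/-- Given the first `u` moves, if no triple is unsplit, the remaining pairs are disjoint and the
conditional probability is exactly `allSplitProb`. The exceptional cases, an unsplit triple or more
than `M` unsplit pairs, cost at most `1` each and are controlled by Markov's inequality. The
intended `θ` is the limiting probability that `v` moves split a given pair. -/
theorem abs_sepProb_sub_expect_pow_le {n k u v : ℕ} (hk : k ≤ n) {θ : ℝ} (h0 : 0 ≤ θ)
    (h1 : θ ≤ 1) {M : ℕ} (hM : 0 < M) :
    |sepProb n k (u + v) - 𝔼 ω : Fin u → KSet n k, θ ^ (unsplitSets 2 ω).card| ≤
      n.choose 3 * blockProb n k 3 ^ u + n.choose 2 * blockProb n k 2 ^ u / M +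
      ∑ m ∈ Finset.range (M + 1), |allSplitProb n k v m - θ ^ m| := by
  have : Nonempty (KSet n k) := kSet_nonempty hk
  rw [sepProb, expect_append, ← Finset.expect_sub_distrib]
  refine (Finset.abs_expect_le _ _).trans ?_
  have key : ∀ ω : Fin u → KSet n k,
      |(𝔼 ω₂ : Fin v → KSet n k, ind (Separating (Fin.append ω ω₂))) -
        θ ^ (unsplitSets 2 ω).card| ≤
      (unsplitSets 3 ω).card + ((unsplitSets 2 ω).card : ℝ) / M +
        ∑ m ∈ Finset.range (M + 1), |allSplitProb n k v m - θ ^ m| := by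
    intro ω
    have hs : 0 ≤ ∑ m ∈ Finset.range (M + 1), |allSplitProb n k v m - θ ^ m| :=
      Finset.sum_nonneg fun _ _ => abs_nonneg _
    have hMp : (0 : ℝ) < M := by exact_mod_cast hM
    have hdiv : 0 ≤ ((unsplitSets 2 ω).card : ℝ) / M := by positivity
    have htriv : |(𝔼 ω₂ : Fin v → KSet n k, ind (Separating (Fin.append ω ω₂))) -
        θ ^ (unsplitSets 2 ω).card| ≤ 1 := by
      have e0 : 0 ≤ 𝔼 ω₂ : Fin v → KSet n k, ind (Separating (Fin.append ω ω₂)) :=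
        Finset.expect_nonneg fun _ _ => ind_nonneg _
      have e1 : 𝔼 ω₂ : Fin v → KSet n k, ind (Separating (Fin.append ω ω₂)) ≤ 1 :=
        Finset.expect_le Finset.univ_nonempty fun _ _ => ind_le_one _
      have e2 := pow_nonneg h0 (unsplitSets 2 ω).card
      have e3 := pow_le_one₀ (n := (unsplitSets 2 ω).card) h0 h1
      rw [abs_le]
      constructor <;> linarith
    by_cases h3 : (unsplitSets 3 ω).card = 0
    · by_cases h2 : (unsplitSets 2 ω).card ≤ M
      · simp only [separating_append_iff]
        rw [expect_forall_not_neverSplit hk v (fun p hp => (mem_unsplitSets.1 hp).1)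
          (pairwiseDisjoint_unsplitSets h3)]
        have := Finset.single_le_sum (f := fun m => |allSplitProb n k v m - θ ^ m|)
          (fun _ _ => abs_nonneg _) (Finset.mem_range.2 (Nat.lt_succ_of_le h2))
        have : (0 : ℝ) ≤ (unsplitSets 3 ω).card := Nat.cast_nonneg _
        linarith
      · have : (1 : ℝ) ≤ ((unsplitSets 2 ω).card : ℝ) / M := by
          rw [one_le_div hMp]
          exact_mod_cast (by omega : M ≤ (unsplitSets 2 ω).card)
        have : (0 : ℝ) ≤ (unsplitSets 3 ω).card := Nat.cast_nonneg _
        linarith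
    · have : (1 : ℝ) ≤ (unsplitSets 3 ω).card := by
        exact_mod_cast Nat.one_le_iff_ne_zero.2 h3
      linarith
  refine (Finset.expect_le_expect fun ω _ => key ω).trans (le_of_eq ?_)
  rw [Finset.expect_add_distrib, Finset.expect_add_distrib, Fintype.expect_const,
    ← Finset.expect_div, expect_card_unsplitSets hk u two_pos,
    expect_card_unsplitSets hk u three_pos]

theorem abs_exp_sub_exp_le {x y : ℝ} (hx : x ≤ 0) (hy : y ≤ 0) :
    |Real.exp x - Real.exp y| ≤ |x - y| := by
  wlog h : y ≤ x generalizing x y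
  · rw [abs_sub_comm, abs_sub_comm x]
    exact this hy hx (le_of_not_ge h)
  rw [abs_of_nonneg (sub_nonneg.2 (Real.exp_le_exp.2 h)), abs_of_nonneg (sub_nonneg.2 h)]
  have h1 := Real.add_one_le_exp (y - x)
  have h2 : Real.exp y = Real.exp x * Real.exp (y - x) := by rw [← Real.exp_add]; ring_nf
  have h3 : Real.exp x ≤ 1 := Real.exp_le_one_iff.2 hx
  have h4 := Real.exp_pos x
  rw [h2]
  nlinarith

/-- If a random number is close to `ν` in mean square, then its generating function is close to
`θ ^ ν`. -/
theorem abs_expect_pow_sub_exp_le {α : Type*} [Fintype α] [Nonempty α] (W : α → ℕ) {θ ν s : ℝ}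
    (h0 : 0 < θ) (h1 : θ ≤ 1) (hν : 0 ≤ ν) (hs : 0 < s) :
    |𝔼 ω, θ ^ W ω - Real.exp (ν * Real.log θ)| ≤
      -Real.log θ * ((s + (𝔼 ω, (W ω : ℝ) ^ 2 - 2 * ν * 𝔼 ω, (W ω : ℝ) + ν ^ 2) / s) / 2) := by
  have hl : Real.log θ ≤ 0 := Real.log_nonpos h0.le h1
  have key : ∀ ω, |θ ^ W ω - Real.exp (ν * Real.log θ)| ≤
      -Real.log θ * ((s + ((W ω : ℝ) ^ 2 - 2 * ν * W ω + ν ^ 2) / s) / 2) := by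
    intro ω
    have e : θ ^ W ω = Real.exp (W ω * Real.log θ) := by
      rw [Real.exp_nat_mul, Real.exp_log h0]
    rw [e]
    refine (abs_exp_sub_exp_le (mul_nonpos_of_nonneg_of_nonpos (Nat.cast_nonneg _) hl)
      (mul_nonpos_of_nonneg_of_nonpos hν hl)).trans ?_
    rw [← sub_mul, abs_mul, abs_of_nonpos hl, mul_comm]
    refine mul_le_mul_of_nonneg_left ?_ (by linarith)
    -- With `d = |W - ν|`, the inequality `d ≤ (s + d^2/s)/2` is `(d - s)^2 ≥ 0`; the free scale `s`
    -- is later taken to be `√ν`.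
    have h2 : ((W ω : ℝ) ^ 2 - 2 * ν * W ω + ν ^ 2) = |(W ω : ℝ) - ν| ^ 2 := by
      rw [sq_abs]; ring
    rw [h2, le_div_iff₀ two_pos, ← mul_le_mul_iff_left₀ hs, add_mul, div_mul_cancel₀ _ hs.ne']
    nlinarith [sq_nonneg (|(W ω : ℝ) - ν| - s)]
  have hc : Real.exp (ν * Real.log θ) = 𝔼 _ω : α, Real.exp (ν * Real.log θ) :=
    (Fintype.expect_const _).symm
  rw [hc, ← Finset.expect_sub_distrib]
  refine ((Finset.abs_expect_le _ _).trans (Finset.expect_le_expect fun ω _ => key ω)).trans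
    (le_of_eq ?_)
  rw [← Finset.mul_expect, ← Finset.expect_div, Finset.expect_add_distrib, Fintype.expect_const,
    ← Finset.expect_div, Finset.expect_add_distrib, Finset.expect_sub_distrib,
    Fintype.expect_const, ← Finset.mul_expect]

/-! ### Limits and bounds for falling factorials -/

theorem tendsto_cast_sub_div {m : ℕ → ℕ} {γ : ℝ}
    (hm : Tendsto (fun n : ℕ => (m n : ℝ) / n) atTop (𝓝 γ)) (i : ℕ) :
    Tendsto (fun n : ℕ => ((m n - i : ℕ) : ℝ) / n) atTop (𝓝 γ) := by
  have h1 : Tendsto (fun n : ℕ => (m n : ℝ) / n - (i : ℝ) / n) atTop (𝓝 γ) := by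
    simpa using hm.sub (tendsto_const_div_atTop_nhds_zero_nat (i : ℝ))
  refine tendsto_of_tendsto_of_tendsto_of_le_of_le h1 hm (fun n => ?_) (fun n => ?_)
  · rw [← sub_div]
    refine div_le_div_of_nonneg_right ?_ (Nat.cast_nonneg n)
    have : m n ≤ (m n - i) + i := by omega
    have : (m n : ℝ) ≤ (m n - i : ℕ) + i := by exact_mod_cast this
    linarith
  · refine div_le_div_of_nonneg_right ?_ (Nat.cast_nonneg n)
    exact Nat.cast_le.2 (Nat.sub_le _ _)

theorem tendsto_descFactorial_div_pow {m : ℕ → ℕ} {γ : ℝ}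
    (hm : Tendsto (fun n : ℕ => (m n : ℝ) / n) atTop (𝓝 γ)) (b : ℕ) :
    Tendsto (fun n : ℕ => ((m n).descFactorial b : ℝ) / (n : ℝ) ^ b) atTop (𝓝 (γ ^ b)) := by
  have h := tendsto_finsetProd (Finset.range b) fun i _ => tendsto_cast_sub_div hm i
  simp only [Finset.prod_const, Finset.card_range, Finset.prod_div_distrib] at h
  refine h.congr fun n => ?_
  rw [Nat.descFactorial_eq_prod_range, Nat.cast_prod]

theorem tendsto_self_div_self : Tendsto (fun n : ℕ => (n : ℝ) / n) atTop (𝓝 1) := by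
  refine tendsto_const_nhds.congr' ?_
  filter_upwards [eventually_ne_atTop 0] with n hn
  rw [div_self (by exact_mod_cast hn)]

theorem tendsto_choose_two_div_sq :
    Tendsto (fun n : ℕ => (n.choose 2 : ℝ) / (n : ℝ) ^ 2) atTop (𝓝 (1 / 2)) := by
  have h := (tendsto_descFactorial_div_pow tendsto_self_div_self 2).div_const 2
  rw [one_pow] at h
  refine h.congr fun n => ?_
  rw [Nat.descFactorial_eq_factorial_mul_choose]
  push_cast
  rw [Nat.factorial_two]
  push_cast
  ring

theorem blockProb_two (n k : ℕ) : blockProb n k 2 = pairAgreement n k :=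
  (pairAgreement_eq n k).symm

/-- Two disjoint pairs are almost uncorrelated. The numerator only needs `(m)_4 ≤ (m)_2^2` for
falling factorials; the excess is `n(n-1)/((n-2)(n-3))`, and its power over a logarithmic number of
moves tends to `1`. -/
theorem pairsProb_two_le {n k : ℕ} (hn : 6 ≤ n) :
    pairsProb n k 2 ≤ pairAgreement n k ^ 2 * (1 + 12 / n) := by
  have h4 : ∀ m : ℕ, (m.descFactorial 4 : ℝ) ≤ (m.descFactorial 2 : ℝ) ^ 2 := fun m => by
    have h : m.descFactorial 4 ≤ m.descFactorial 2 ^ 2 := by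
      simp only [Nat.descFactorial, Nat.sub_zero, mul_one, sq, mul_assoc]
      rw [← mul_assoc (m - 3)]
      exact (Nat.mul_le_mul (Nat.mul_le_mul (by omega : m - 3 ≤ m - 1) (by omega : m - 2 ≤ m))
        le_rfl).trans (by rw [mul_assoc])
    exact_mod_cast h
  have hn6 : (6 : ℝ) ≤ n := by exact_mod_cast hn
  have hn2 : (n.descFactorial 2 : ℝ) = n * (n - 1) := by
    simp [Nat.descFactorial, Nat.cast_sub (by omega : 1 ≤ n), mul_comm]
  have hn4 : (n.descFactorial 4 : ℝ) = n * (n - 1) * ((n - 2) * (n - 3)) := by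
    simp only [Nat.descFactorial, Nat.sub_zero, mul_one, Nat.cast_mul,
      Nat.cast_sub (by omega : 1 ≤ n), Nat.cast_sub (by omega : 2 ≤ n),
      Nat.cast_sub (by omega : 3 ≤ n)]
    push_cast
    ring
  have e : pairsProb n k 2 = (((n - k).descFactorial 4 : ℝ) +
      2 * (k.descFactorial 2 * (n - k).descFactorial 2) + k.descFactorial 4) /
      n.descFactorial 4 := by
    simp only [pairsProb, Finset.sum_range_succ, Finset.sum_range_zero, patternProb]
    norm_num
    ring
  have e2 : pairAgreement n k =
      ((k.descFactorial 2 : ℝ) + (n - k).descFactorial 2) / n.descFactorial 2 := by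
    simp only [pairAgreement_eq, patternProb]
    norm_num
    ring
  rw [e, e2, div_pow, div_mul_eq_mul_div, hn2, hn4]
  have hp1 : 0 < (n : ℝ) * (n - 1) * ((n - 2) * (n - 3)) := by
    have : (0 : ℝ) < n - 1 := by linarith
    have : (0 : ℝ) < n - 2 := by linarith
    have : (0 : ℝ) < n - 3 := by linarith
    positivity
  have hp2 : 0 < (n : ℝ) * (n - 1) := mul_pos (by linarith) (by linarith)
  rw [div_le_div_iff₀ hp1 (by positivity)]
  have hA : ((n - k).descFactorial 4 : ℝ) +
      2 * (k.descFactorial 2 * (n - k).descFactorial 2) + k.descFactorial 4 ≤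
      ((k.descFactorial 2 : ℝ) + (n - k).descFactorial 2) ^ 2 := by
    have := h4 k
    have := h4 (n - k)
    linarith [add_sq (k.descFactorial 2 : ℝ) ((n - k).descFactorial 2 : ℝ)]
  have hB : (n : ℝ) * (n - 1) ≤ (1 + 12 / n) * ((n - 2) * (n - 3)) := by
    rw [one_add_div (by linarith : (n : ℝ) ≠ 0), div_mul_eq_mul_div, le_div_iff₀ (by linarith)]
    nlinarith
  calc _ ≤ ((k.descFactorial 2 : ℝ) + (n - k).descFactorial 2) ^ 2 * ((n : ℝ) * (n - 1)) ^ 2 :=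
        mul_le_mul_of_nonneg_right hA (by positivity)
    _ = ((k.descFactorial 2 : ℝ) + (n - k).descFactorial 2) ^ 2 * ((n : ℝ) * (n - 1)) *
        ((n : ℝ) * (n - 1)) := by ring
    _ ≤ ((k.descFactorial 2 : ℝ) + (n - k).descFactorial 2) ^ 2 * ((n : ℝ) * (n - 1)) *
        ((1 + 12 / n) * ((n - 2) * (n - 3))) := mul_le_mul_of_nonneg_left hB (by positivity)
    _ = _ := by ring

theorem tendsto_pow_zero_of_tendsto {r : ℕ → ℝ} {u : ℕ → ℕ} {ρ : ℝ} (hr0 : ∀ n, 0 ≤ r n)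
    (hr : Tendsto r atTop (𝓝 ρ)) (hρ : ρ < 1) (hu : Tendsto u atTop atTop) :
    Tendsto (fun n => r n ^ u n) atTop (𝓝 0) := by
  have hρ0 : 0 ≤ ρ := ge_of_tendsto' hr hr0
  obtain ⟨y, hy1, hy2⟩ := exists_between hρ
  refine squeeze_zero' (Eventually.of_forall fun n => pow_nonneg (hr0 n) _) ?_
    ((tendsto_pow_atTop_nhds_zero_of_lt_one (hρ0.trans hy1.le) hy2).comp hu)
  filter_upwards [hr.eventually_le_const hy1] with n hn
  exact pow_le_pow_left₀ (hr0 n) hn _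

/-! ### Limits in the dense regime -/

section DenseAsymptotics

variable {k t : ℕ → ℕ} {c α : ℝ} {ε : ℕ → ℝ} (hk : ∀ᶠ n : ℕ in atTop, 1 ≤ k n ∧ k n ≤ n)
  (hα0 : 0 < α) (hα1 : α < 1) (hα : Tendsto (fun n : ℕ => (k n : ℝ) / n) atTop (𝓝 α))
  (hε : Tendsto ε atTop (𝓝 0))
  (ht : ∀ᶠ n : ℕ in atTop,
    (t n : ℝ) = (2 * Real.log n + c + ε n) / (-Real.log (pairAgreement n (k n))))

include hk hα in
theorem tendsto_patternProb (b z : ℕ) :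
    Tendsto (fun n : ℕ => patternProb n (k n) b z) atTop (𝓝 (α ^ b * (1 - α) ^ z)) := by
  have hc : Tendsto (fun n : ℕ => ((n - k n : ℕ) : ℝ) / n) atTop (𝓝 (1 - α)) := by
    refine (tendsto_self_div_self.sub hα).congr' ?_
    filter_upwards [hk] with n hn
    rw [Nat.cast_sub hn.2, sub_div]
  have h := ((tendsto_descFactorial_div_pow hα b).mul (tendsto_descFactorial_div_pow hc z)).div
    (tendsto_descFactorial_div_pow tendsto_self_div_self (b + z)) (by simp)
  rw [one_pow, div_one] at h
  refine h.congr' ?_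
  filter_upwards [eventually_ne_atTop 0] with n hn
  have hn' : (n : ℝ) ^ (b + z) ≠ 0 := pow_ne_zero _ (by exact_mod_cast hn)
  simp only [Pi.div_apply]
  rw [patternProb, div_mul_div_comm, ← pow_add, div_div_div_cancel_right₀ hn']

include hk hα in
theorem tendsto_pairsProb (j : ℕ) :
    Tendsto (fun n : ℕ => pairsProb n (k n) j) atTop (𝓝 ((α ^ 2 + (1 - α) ^ 2) ^ j)) := by
  rw [add_pow]
  refine tendsto_finsetSum _ fun i _ => ?_
  rw [← pow_mul, ← pow_mul, mul_comm (_ * _) (j.choose i : ℝ)]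
  exact (tendsto_patternProb hk hα _ _).const_mul _

include hk hα in
theorem tendsto_pairAgreement :
    Tendsto (fun n : ℕ => pairAgreement n (k n)) atTop (𝓝 (α ^ 2 + (1 - α) ^ 2)) := by
  simpa [pairsProb_one] using tendsto_pairsProb hk hα 1

include hk hα in
theorem tendsto_blockProb (r : ℕ) :
    Tendsto (fun n : ℕ => blockProb n (k n) r) atTop (𝓝 (α ^ r + (1 - α) ^ r)) := by
  simpa [blockProb] using (tendsto_patternProb hk hα r 0).add (tendsto_patternProb hk hα 0 r)

include hk hα in
theorem tendsto_allSplitProb (v m : ℕ) :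
    Tendsto (fun n : ℕ => allSplitProb n (k n) v m) atTop
      (𝓝 ((1 - (α ^ 2 + (1 - α) ^ 2) ^ v) ^ m)) := by
  rw [sub_eq_neg_add, add_pow]
  refine tendsto_finsetSum _ fun j _ => ?_
  rw [one_pow, mul_one, mul_comm, neg_pow (_ ^ v), ← pow_mul, mul_comm v, pow_mul]
  exact (((tendsto_pairsProb hk hα j).pow v).const_mul _).const_mul _

include hα0 hα1 in
theorem pairLimit_pos : 0 < α ^ 2 + (1 - α) ^ 2 := by positivity

include hα0 hα1 in
theorem pairLimit_lt_one : α ^ 2 + (1 - α) ^ 2 < 1 := by nlinarith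

include hα0 hα1 in
-- The 3-norm of `(α, 1-α)` is strictly below its 2-norm. Hence `n^3` triples die out on the time
-- scale where `n^2` pairs survive in bounded number.
theorem tripleLimit_sq_lt : (α ^ 3 + (1 - α) ^ 3) ^ 2 / (α ^ 2 + (1 - α) ^ 2) ^ 3 < 1 := by
  have hq := pairLimit_pos hα0 hα1
  rw [div_lt_one (by positivity)]
  have hβ : 0 < 1 - α := by linarith
  have e : (α ^ 2 + (1 - α) ^ 2) ^ 3 - (α ^ 3 + (1 - α) ^ 3) ^ 2 =
      α ^ 2 * (1 - α) ^ 2 * (2 * α ^ 2 + 2 * (1 - α) ^ 2 + (α - (1 - α)) ^ 2) := by ring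
  have : 0 < (α ^ 2 + (1 - α) ^ 2) ^ 3 - (α ^ 3 + (1 - α) ^ 3) ^ 2 := by rw [e]; positivity
  linarith

include hk hα hα0 hα1 in
theorem tendsto_neg_log_pairAgreement :
    Tendsto (fun n : ℕ => -Real.log (pairAgreement n (k n))) atTop
      (𝓝 (-Real.log (α ^ 2 + (1 - α) ^ 2))) :=
  ((Real.continuousAt_log (pairLimit_pos hα0 hα1).ne').tendsto.comp
    (tendsto_pairAgreement hk hα)).neg

include hα0 hα1 in
theorem neg_log_pairLimit_pos : 0 < -Real.log (α ^ 2 + (1 - α) ^ 2) :=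
  neg_pos.2 (Real.log_neg (pairLimit_pos hα0 hα1) (pairLimit_lt_one hα0 hα1))

include hk hα hα0 hα1 hε ht in
theorem tendsto_dense_time : Tendsto t atTop atTop := by
  rw [← tendsto_natCast_atTop_iff (R := ℝ)]
  have h1 : Tendsto (fun n : ℕ => 2 * Real.log n + (c + ε n)) atTop atTop :=
    ((Real.tendsto_log_atTop.comp tendsto_natCast_atTop_atTop).const_mul_atTop
      two_pos).atTop_add (tendsto_const_nhds.add hε)
  have h2 := h1.atTop_mul_pos (inv_pos.2 (neg_log_pairLimit_pos hα0 hα1))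
    ((tendsto_neg_log_pairAgreement hk hα0 hα1 hα).inv₀ (neg_log_pairLimit_pos hα0 hα1).ne')
  refine h2.congr' ?_
  filter_upwards [ht] with n hn
  rw [hn, div_eq_mul_inv, add_assoc]

include hk hα hα0 hα1 hε ht in
theorem tendsto_dense_time_div : Tendsto (fun n : ℕ => (t n : ℝ) / n) atTop (𝓝 0) := by
  have hl : Tendsto (fun n : ℕ => Real.log n / (n : ℝ)) atTop (𝓝 0) := by
    have := Real.isLittleO_log_id_atTop.tendsto_div_nhds_zero.comp
      (tendsto_natCast_atTop_atTop (R := ℝ))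
    exact this
  have h1 : Tendsto (fun n : ℕ => 2 * (Real.log n / (n : ℝ)) + (c + ε n) * (1 / (n : ℝ))) atTop
      (𝓝 0) := by
    have := (hl.const_mul 2).add ((tendsto_const_nhds.add hε : Tendsto (fun n => c + ε n) atTop
      (𝓝 (c + 0))).mul (tendsto_const_div_atTop_nhds_zero_nat (1 : ℝ)))
    simpa using this
  have h2 := h1.div (tendsto_neg_log_pairAgreement hk hα0 hα1 hα)
    (neg_log_pairLimit_pos hα0 hα1).ne'
  rw [zero_div] at h2
  refine h2.congr' ?_
  filter_upwards [ht] with n hn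
  simp only [Pi.div_apply]
  rw [hn]
  ring

include hk hα hα0 hα1 hε ht in
-- The prescribed time makes the `t n`-th power exactly `e^{-(c+ε)}/n^2`; omitting `L` moves divides
-- it by a power tending to `q^L`.
theorem tendsto_sq_mul_pairAgreement_pow (L : ℕ) :
    Tendsto (fun n : ℕ => (n : ℝ) ^ 2 * pairAgreement n (k n) ^ (t n - L)) atTop
      (𝓝 (Real.exp (-c) / (α ^ 2 + (1 - α) ^ 2) ^ L)) := by
  have hq := pairLimit_pos hα0 hα1
  have h1 : Tendsto (fun n : ℕ => Real.exp (-(c + ε n))) atTop (𝓝 (Real.exp (-c))) := by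
    have : Tendsto (fun n => -(c + ε n)) atTop (𝓝 (-c)) := by
      simpa using (hε.const_add c).neg
    exact (Real.continuous_exp.tendsto _).comp this
  have h2 := h1.div ((tendsto_pairAgreement hk hα).pow L) (pow_pos hq L).ne'
  refine h2.congr' ?_
  filter_upwards [ht, (tendsto_pairAgreement hk hα).eventually_const_lt hq,
    (tendsto_neg_log_pairAgreement hk hα0 hα1 hα).eventually_const_lt
      (neg_log_pairLimit_pos hα0 hα1),
    (tendsto_dense_time hk hα0 hα1 hα hε ht).eventually_ge_atTop L,
    eventually_gt_atTop 0] with n hn hqn hln hL hn0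
  have hnp : (0 : ℝ) < n := by exact_mod_cast hn0
  have e : pairAgreement n (k n) ^ t n = Real.exp (-(c + ε n)) / (n : ℝ) ^ 2 := by
    rw [eq_div_iff (by positivity), ← Real.rpow_natCast, Real.rpow_def_of_pos hqn, hn]
    have e1 : Real.log (pairAgreement n (k n)) *
        ((2 * Real.log n + c + ε n) / -Real.log (pairAgreement n (k n))) =
        -(c + ε n) - 2 * Real.log n := by
      have : Real.log (pairAgreement n (k n)) ≠ 0 := by linarith
      field_simp
      ring
    have e2 : (n : ℝ) ^ 2 = Real.exp (2 * Real.log n) := by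
      rw [mul_comm, Real.exp_mul, Real.exp_log hnp]; norm_cast
    rw [e1, e2, ← Real.exp_add]
    ring_nf
  simp only [Pi.div_apply]
  rw [pow_sub₀ _ hqn.ne' hL, e]
  field_simp

include hk hα hα0 hα1 hε ht in
theorem tendsto_expect_pairs (L : ℕ) :
    Tendsto (fun n : ℕ => (n.choose 2 : ℝ) * blockProb n (k n) 2 ^ (t n - L)) atTop
      (𝓝 (1 / 2 * Real.exp (-c) / (α ^ 2 + (1 - α) ^ 2) ^ L)) := by
  have h := tendsto_choose_two_div_sq.mul
    (tendsto_sq_mul_pairAgreement_pow hk hα0 hα1 hα hε ht L)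
  rw [← mul_div_assoc] at h
  refine h.congr' ?_
  filter_upwards [eventually_ne_atTop 0] with n hn
  have hn' : (n : ℝ) ≠ 0 := by exact_mod_cast hn
  rw [blockProb_two]
  field_simp

include hk hα hα0 hα1 hε ht in
theorem tendsto_expect_triples (L : ℕ) :
    Tendsto (fun n : ℕ => (n.choose 3 : ℝ) * blockProb n (k n) 3 ^ (t n - L)) atTop (𝓝 0) := by
  have hq := pairLimit_pos hα0 hα1
  have hu : Tendsto (fun n => t n - L) atTop atTop :=
    (tendsto_sub_atTop_nat L).comp (tendsto_dense_time hk hα0 hα1 hα hε ht)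
  have hr := tendsto_pow_zero_of_tendsto
    (r := fun n => blockProb n (k n) 3 ^ 2 / pairAgreement n (k n) ^ 3)
    (fun n => div_nonneg (sq_nonneg _) (pow_nonneg (pairAgreement_nonneg _ _) _))
    (((tendsto_blockProb hk hα 3).pow 2).div ((tendsto_pairAgreement hk hα).pow 3)
      (pow_pos hq 3).ne') (tripleLimit_sq_lt hα0 hα1) hu
  -- With `b` the triple probability, `(n^3 b^u)^2 = (n^2 q^u)^3 (b^2/q^3)^u`: a bounded factor
  -- times a geometrically small one.
  have h1 := ((tendsto_sq_mul_pairAgreement_pow hk hα0 hα1 hα hε ht L).pow 3).mul hr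
  rw [mul_zero] at h1
  have h2 := (Real.continuous_sqrt.tendsto 0).comp h1
  rw [Real.sqrt_zero] at h2
  refine squeeze_zero' (Eventually.of_forall fun n =>
    mul_nonneg (Nat.cast_nonneg _) (pow_nonneg (blockProb_nonneg _ _ _) _)) ?_ h2
  filter_upwards [(tendsto_pairAgreement hk hα).eventually_const_lt hq] with n hqn
  have h3 : (n.choose 3 : ℝ) ≤ (n : ℝ) ^ 3 := by exact_mod_cast Nat.choose_le_pow n 3
  refine (mul_le_mul_of_nonneg_right h3 (pow_nonneg (blockProb_nonneg _ _ _) _)).trans ?_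
  refine Real.le_sqrt_of_sq_le (le_of_eq ?_)
  simp only
  rw [div_pow]
  field_simp
  ring

include hk hα hα0 hα1 hε ht in
theorem tendsto_disjoint_pairs_bound (L : ℕ) :
    Tendsto (fun n : ℕ => ((n.choose 2 : ℝ) * blockProb n (k n) 2 ^ (t n - L)) ^ 2 *
      Real.exp (12 * (t n / n))) atTop
      (𝓝 ((1 / 2 * Real.exp (-c) / (α ^ 2 + (1 - α) ^ 2) ^ L) ^ 2)) := by
  have h1 := (Real.continuous_exp.tendsto _).comp
    ((tendsto_dense_time_div hk hα0 hα1 hα hε ht).const_mul 12)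
  have h2 := ((tendsto_expect_pairs hk hα0 hα1 hα hε ht L).pow 2).mul h1
  simpa using h2

theorem sq_mul_pairsProb_two_pow_le {n k : ℕ} (hn : 6 ≤ n) (t L : ℕ) :
    (n.choose 2 : ℝ) ^ 2 * pairsProb n k 2 ^ (t - L) ≤
      ((n.choose 2 : ℝ) * blockProb n k 2 ^ (t - L)) ^ 2 * Real.exp (12 * (t / n)) := by
  rw [mul_pow, mul_assoc]
  refine mul_le_mul_of_nonneg_left ?_ (by positivity)
  have hnp : (0 : ℝ) < n := by exact_mod_cast (by omega : 0 < n)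
  have h1 := pow_le_pow_left₀ (pairsProb_nonneg n k 2) (pairsProb_two_le (k := k) hn) (t - L)
  refine h1.trans ?_
  rw [mul_pow, ← pow_mul, mul_comm 2, pow_mul, blockProb_two]
  refine mul_le_mul_of_nonneg_left ?_ (by positivity)
  have h2 := pow_le_pow_left₀ (by positivity)
    ((add_comm (1 : ℝ) (12 / n)).trans_le (Real.add_one_le_exp (12 / (n : ℝ)))) (t - L)
  refine h2.trans ?_
  rw [← Real.exp_nat_mul]
  refine Real.exp_le_exp.2 ?_
  have h3 : ((t - L : ℕ) : ℝ) ≤ t := by exact_mod_cast Nat.sub_le _ _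
  calc ((t - L : ℕ) : ℝ) * (12 / n) ≤ t * (12 / n) :=
        mul_le_mul_of_nonneg_right h3 (by positivity)
    _ = _ := by ring

include hk hα hα0 hα1 hε ht in
/-- Comparison of the separation probability with the generating function of the number of pairs
of cards not yet told apart `L` steps before the end. -/
theorem exists_tendsto_abs_sepProb_sub_le {L M : ℕ} (hL : 0 < L) (hM : 0 < M) :
    ∃ B : ℕ → ℝ, (∀ᶠ n in atTop, |sepProb n (k n) (t n) -
        Real.exp (1 / 2 * Real.exp (-c) / (α ^ 2 + (1 - α) ^ 2) ^ L *
          Real.log (1 - (α ^ 2 + (1 - α) ^ 2) ^ L))| ≤ B n) ∧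
      Tendsto B atTop (𝓝 (1 / 2 * Real.exp (-c) / (α ^ 2 + (1 - α) ^ 2) ^ L / M +
        -Real.log (1 - (α ^ 2 + (1 - α) ^ 2) ^ L) *
          √(1 / 2 * Real.exp (-c) / (α ^ 2 + (1 - α) ^ 2) ^ L))) := by
  set x := (α ^ 2 + (1 - α) ^ 2) ^ L with hx
  set ν := 1 / 2 * Real.exp (-c) / x with hν
  have hq := pairLimit_pos hα0 hα1
  have hx0 : 0 < x := pow_pos hq L
  have hx1 : x < 1 := pow_lt_one₀ hq.le (pairLimit_lt_one hα0 hα1) hL.ne'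
  have hν0 : 0 < ν := by positivity
  have hW := tendsto_expect_pairs hk hα0 hα1 hα hε ht L
  have hT := tendsto_expect_triples hk hα0 hα1 hα hε ht L
  have hD := tendsto_disjoint_pairs_bound hk hα0 hα1 hα hε ht L
  rw [← hx, ← hν] at hW hD
  have hS : Tendsto (fun n => ∑ m ∈ Finset.range (M + 1),
      |allSplitProb n (k n) L m - (1 - x) ^ m|) atTop (𝓝 0) := by
    have := tendsto_finsetSum (Finset.range (M + 1)) fun m _ =>
      ((tendsto_allSplitProb hk hα L m).sub_const ((1 - x) ^ m)).abs
    simpa [hx] using this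
  -- The first group is the conditioning error with `θ = 1 - x`; the second is the mean-square error
  -- with the scale `s = √ν`.
  refine ⟨fun n => (n.choose 3 * blockProb n (k n) 3 ^ (t n - L) +
      n.choose 2 * blockProb n (k n) 2 ^ (t n - L) / M +
      ∑ m ∈ Finset.range (M + 1), |allSplitProb n (k n) L m - (1 - x) ^ m|) +
      -Real.log (1 - x) * ((√ν + ((n.choose 2 * blockProb n (k n) 2 ^ (t n - L) +
        9 * (n.choose 3 * blockProb n (k n) 3 ^ (t n - L)) +
        ((n.choose 2 : ℝ) * blockProb n (k n) 2 ^ (t n - L)) ^ 2 * Real.exp (12 * (t n / n))) -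
        2 * ν * (n.choose 2 * blockProb n (k n) 2 ^ (t n - L)) + ν ^ 2) / √ν) / 2), ?_, ?_⟩
  · filter_upwards [hk, (tendsto_dense_time hk hα0 hα1 hα hε ht).eventually_ge_atTop L,
      eventually_ge_atTop 6] with n hkn hLn hn6
    have : Nonempty (KSet n (k n)) := kSet_nonempty hkn.2
    have h1 := abs_sepProb_sub_expect_pow_le hkn.2 (u := t n - L) (v := L)
      (sub_nonneg.2 hx1.le) (sub_le_self 1 hx0.le) hM
    rw [Nat.sub_add_cancel hLn] at h1
    have h2 := abs_expect_pow_sub_exp_le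
      (fun ω : Fin (t n - L) → KSet n (k n) => (unsplitSets 2 ω).card)
      (sub_pos.2 hx1) (sub_le_self 1 hx0.le) hν0.le (Real.sqrt_pos.2 hν0)
    refine (abs_sub_le _ _ _).trans (add_le_add h1 (h2.trans ?_))
    have hl : 0 ≤ -Real.log (1 - x) :=
      neg_nonneg.2 (Real.log_nonpos (sub_nonneg.2 hx1.le) (sub_le_self 1 hx0.le))
    rw [expect_card_unsplitSets hkn.2 _ two_pos]
    have h3 := (expect_card_unsplitSets_two_sq_le hkn.2 (t n - L)).trans
      (add_le_add_right (sq_mul_pairsProb_two_pow_le (k := k n) hn6 (t n) L) _)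
    gcongr
  · have hlim := ((hT.add (hW.div_const (M : ℝ))).add hS).add
      (((((((hW.add (hT.const_mul 9)).add hD).sub (hW.const_mul (2 * ν))).add_const
        (ν ^ 2)).div_const (√ν)).const_add (√ν)).div_const 2 |>.const_mul (-Real.log (1 - x)))
    convert hlim using 2
    -- The bound on the mean square deviation tends to `ν`, so with this scale both halves of the
    -- error are equal.
    have e : (ν + 9 * 0 + ν ^ 2 - 2 * ν * ν + ν ^ 2) / √ν = √ν := by
      rw [div_eq_iff (Real.sqrt_pos.2 hν0).ne', Real.mul_self_sqrt hν0.le]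
      ring
    rw [e]
    ring

theorem tendsto_log_one_sub_div :
    Tendsto (fun x : ℝ => Real.log (1 - x) / x) (𝓝[>] 0) (𝓝 (-1)) := by
  have h : HasDerivAt (fun x : ℝ => Real.log (1 - x)) (-1) 0 := by
    have := ((hasDerivAt_id (0 : ℝ)).const_sub 1).log (by simp)
    simpa using this
  have h2 := h.tendsto_slope_zero_right
  refine h2.congr fun x => ?_
  simp [div_eq_inv_mul]

include hk hα hα0 hα1 hε ht in
theorem tendsto_sepProb_dense :
    Tendsto (fun n : ℕ => sepProb n (k n) (t n)) atTop
      (𝓝 (Real.exp (-(1 / 2 * Real.exp (-c))))) := by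
  set μ := 1 / 2 * Real.exp (-c) with hμ
  have hμ0 : 0 < μ := by positivity
  set q := α ^ 2 + (1 - α) ^ 2 with hqdef
  have hq : 0 < q := pairLimit_pos hα0 hα1
  have hq1 : q < 1 := pairLimit_lt_one hα0 hα1
  have hx0 : Tendsto (fun L : ℕ => q ^ L) atTop (𝓝 0) :=
    tendsto_pow_atTop_nhds_zero_of_lt_one hq.le hq1
  have hx : Tendsto (fun L : ℕ => q ^ L) atTop (𝓝[>] 0) :=
    tendsto_nhdsWithin_iff.2 ⟨hx0, Eventually.of_forall fun L => pow_pos hq L⟩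
  have hlog := tendsto_log_one_sub_div.comp hx
  have hexp : Tendsto (fun L : ℕ => Real.exp (μ / q ^ L * Real.log (1 - q ^ L))) atTop
      (𝓝 (Real.exp (-μ))) := by
    refine (Real.continuous_exp.tendsto _).comp ?_
    have := hlog.const_mul μ
    rw [mul_neg_one] at this
    refine this.congr fun L => ?_
    simp only [Function.comp]
    ring
  have hvar : Tendsto (fun L : ℕ => -Real.log (1 - q ^ L) * √(μ / q ^ L)) atTop (𝓝 0) := by
    have h1 : Tendsto (fun L : ℕ => √(μ * q ^ L)) atTop (𝓝 0) := by
      have := (Real.continuous_sqrt.tendsto _).comp (hx0.const_mul μ)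
      simpa [Function.comp_def] using this
    have h2 := hlog.neg.mul h1
    rw [mul_zero] at h2
    refine h2.congr fun L => ?_
    have hL : 0 < q ^ L := pow_pos hq L
    -- Since `-log(1 - x)` is of order `x`, it outweighs the growth of `√(μ/x)` as `x = q^L` tends
    -- to `0`.
    have e : √(μ * q ^ L) = q ^ L * √(μ / q ^ L) := by
      have : μ * q ^ L = (q ^ L) ^ 2 * (μ / q ^ L) := by field_simp
      rw [this, Real.sqrt_mul (by positivity), Real.sqrt_sq hL.le]
    simp only [Function.comp]
    rw [e]
    field_simp
  rw [Metric.tendsto_atTop']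
  intro δ hδ
  -- The order of choice matters: `L` makes the limit and fluctuation errors small, then `M`,
  -- depending on `L`, the Markov term, and finally `n` grows.
  obtain ⟨L, hL0, hL1, hL2⟩ := ((eventually_gt_atTop 0).and
    (((Metric.tendsto_nhds.1 hexp) (δ / 3) (by positivity)).and
    (hvar.eventually_lt_const (show (0 : ℝ) < δ / 3 by positivity)))).exists
  have hMlim : Tendsto (fun M : ℕ => μ / q ^ L / (M : ℝ)) atTop (𝓝 0) :=
    tendsto_const_div_atTop_nhds_zero_nat _
  obtain ⟨M, hM0, hM1⟩ := ((eventually_gt_atTop 0).and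
    (hMlim.eventually_lt_const (show (0 : ℝ) < δ / 3 by positivity))).exists
  obtain ⟨B, hB, hBlim⟩ := exists_tendsto_abs_sepProb_sub_le hk hα0 hα1 hα hε ht hL0 hM0
  have hlt := hBlim.eventually_lt_const (add_lt_add hM1 hL2)
  obtain ⟨N, hN⟩ := eventually_atTop.1 (hB.and hlt)
  refine ⟨N, fun n hn => ?_⟩
  have h := hN n hn.le
  rw [Real.dist_eq] at hL1 ⊢
  refine (abs_sub_le _ (Real.exp (μ / q ^ L * Real.log (1 - q ^ L))) _).trans_lt ?_
  calc _ < (δ / 3 + δ / 3) + δ / 3 := add_lt_add (h.1.trans_lt h.2) hL1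
    _ = δ := by ring

end DenseAsymptotics

theorem mainTheorem3 (k : ℕ → ℕ) (hk : ∀ᶠ n : ℕ in atTop, 1 ≤ k n ∧ k n ≤ n) :
    -- sparse regime
    (Tendsto (fun n : ℕ => (k n : ℝ) * Real.log n / n) atTop (𝓝 0) →
      ∀ c : ℝ,
        Tendsto
          (fun n : ℕ => sepKRandomToTop n (k n) ⌊(n : ℝ) / (k n : ℝ) * (Real.log n + c)⌋₊)
          atTop
          (𝓝 (1 - Real.exp (-Real.exp (-c)) * (1 + Real.exp (-c))))) ∧
    -- dense regime
    (∀ α : ℝ, 0 < α → α < 1 →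
      Tendsto (fun n : ℕ => (k n : ℝ) / n) atTop (𝓝 α) →
      ∀ (c : ℝ) (t : ℕ → ℕ) (ε : ℕ → ℝ),
        Tendsto ε atTop (𝓝 0) →
        (∀ᶠ n : ℕ in atTop,
          (t n : ℝ) = (2 * Real.log n + c + ε n) / (-Real.log (pairAgreement n (k n)))) →
        Tendsto (fun n : ℕ => sepKRandomToTop n (k n) (t n)) atTop
          (𝓝 (1 - Real.exp (-(1 / 2 * Real.exp (-c)))))) := by
  simp only [sepKRandomToTop_eq]
  refine ⟨fun hs c => ?_, fun α hα0 hα1 hα c t ε hε ht => ?_⟩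
  · exact (tendsto_sepProb_sparse hk hs (tendsto_floor_mul_ratio_sub_log hk hs c)).const_sub 1
  · exact (tendsto_sepProb_dense hk hα0 hα1 hα hε ht).const_sub 1
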